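/- Let $q$ be a prime power with $q\equiv 1\pmod 3$. Regard the points of $\mathrm{PG}(8,q)$ as nonzero $3\times 3$ matrices over $\mathbb F_q$ up to scalars, with coordinates $X_1,\dots,X_9$ the matrix entries read row by row. Let $\mathcal S_{2,2}$ be the Segre variety of points $(a_ib_j)$ with $a,b\in\mathbb F_q^3\setminus\{0\}$ (the rank-one matrices), let $\mathcal Q(8,q)$ be the quadric $$X_2X_4-X_1X_5+X_3X_7-X_1X_9+X_6X_8-X_5X_9=0,$$ let $\Pi$ be the hyperplane $X_1+X_5+X_9=0$ of trace-zero matrices, and put $\mathcal Q^+(7,q)=\mathcal Q(8,q)\cap\Pi$. Let $\Gamma$ be the point-line geometry whose points are the points of $\Pi\cap\mathcal S_{2,2}$ and whose lines are the lines of $\Pi$ contained in $\Pi\cap\mathcal S_{2,2}$. For a point $x$ of $\Gamma$ let $\pi_x$ be the span of the lines of $\Gamma$ through $x$, and let $\mathcal O=\bigcup_{x\in\Gamma}\pi_x$. Then: 1. $\Gamma$ is isomorphic to the flag geometry of $\mathrm{PG}(2,q)$ (its points are the incident point-line pairs of $\mathrm{PG}(2,q)$, its lines are the points and the lines of $\mathrm{PG}(2,q)$,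 and a flag is incident with its two elements). 2. Through each point $x$ of $\Gamma$ there are exactly two lines of $\Gamma$; they span a plane $\pi_x$, and $\pi_x\subset\mathcal Q^+(7,q)$. 3. $\mathcal Q^+(7,q)$ is a hyperbolic quadric of $\Pi$, and $\mathcal O$ is a $(q^2+q+1)$-ovoid of it. Here a set $\mathcal M$ of points of a hyperbolic quadric $\mathcal Q^+(2r-1,q)$, $r\ge 2$, is an $m$-ovoid, for an integer $m>0$, if for every point $P$ of the quadric $$|P^\perp\cap\mathcal M|=\begin{cases} m\theta_{r-1}-\theta_{r-1}+1 & \text{if } P\in\mathcal M,\\ m\theta_{r-1} & \text{if } P\notin\mathcal M,\end{cases}$$ where $\theta_r=q^{r-1}+1$ and $P^\perp$ is the set of points of the quadric collinear with $P$ (including $P$). 4. $\mathcal O$ is the set of points of $\mathcal Q^+(7,q)$ represented by (trace-zero) matrices of rank at most $2$. 5. The action of $\mathrm{PGL}(3,q)=\mathrm{GL}(3,q)/Z(\mathrm{GL}(3,q))$ on the points of $\Pi$ induced by $M\mapsto AMA^{-1}$ is faithful, and it leaves invariant $\mathcal Q^+(7,q)$, the point set of $\Gamma$, and $\mathcal O$.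 -/

import Mathlib

open scoped LinearAlgebra.Projectivization MatrixGroups

namespace ThinHexagon

noncomputable section

section PolarSpace

variable {F V : Type*} [Field F] [AddCommGroup V] [Module F V]

/-- The points of the quadric `Q = 0` in `PG(V)`: the totally singular one-dimensional subspaces. -/
def quadricPoints (Q : QuadraticForm F V) : Set (ℙ F V) :=
  {P | ∀ v ∈ P.submodule, Q v = 0}

/-- The points of the quadric that are collinear with `P` (for a point `P` of the quadric, which
counts as collinear with itself): those orthogonal to `P` for the polar form of `Q`. -/
def perp (Q : QuadraticForm F V) (P : ℙ F V) : Set (ℙ F V) :=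
  {R | R ∈ quadricPoints Q ∧
    ∀ v ∈ P.submodule, ∀ w ∈ R.submodule, QuadraticMap.polar Q v w = 0}

/-- `Q` is a hyperbolic form of rank `r`, i.e. `Q = 0` is a hyperbolic quadric `Q⁺(2r-1, q)`:
it is isometric to `(f, x) ↦ f x` on `(F ^ r)* × F ^ r`. -/
def IsHyperbolic (Q : QuadraticForm F V) (r : ℕ) : Prop :=
  Q.Equivalent (QuadraticForm.dualProd F (Fin r → F))

/-- `θ_r = q ^ (r - 1) + 1`. -/
def theta (q r : ℕ) : ℤ := (q : ℤ) ^ (r - 1) + 1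

/-- `M` is an `m`-ovoid of the hyperbolic quadric `Q⁺(2r-1, q)` with equation `Q = 0`. -/
structure IsMOvoid (Q : QuadraticForm F V) (r m : ℕ) (M : Set (ℙ F V)) : Prop where
  two_le : 2 ≤ r
  hyperbolic : IsHyperbolic Q r
  subset : M ⊆ quadricPoints Q
  pos : 0 < m
  card_of_mem : ∀ P ∈ quadricPoints Q, P ∈ M →
    ((perp Q P ∩ M).ncard : ℤ) =
      m * theta (Nat.card F) (r - 1) - theta (Nat.card F) (r - 1) + 1
  card_of_notMem : ∀ P ∈ quadricPoints Q, P ∉ M →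
    ((perp Q P ∩ M).ncard : ℤ) = m * theta (Nat.card F) (r - 1)

end PolarSpace

section FlagGeometry

variable (F : Type*) [Field F]

/-- The lines of `PG(2, q)`. -/
def PlaneLine : Type _ :=
  {ℓ : Submodule F (Fin 3 → F) // Module.finrank F ℓ = 2}

/-- The flags (incident point-line pairs) of `PG(2, q)`. -/
def Flag : Type _ :=
  {f : ℙ F (Fin 3 → F) × PlaneLine F // f.1.submodule ≤ f.2.1}

variable {F}

/-- Incidence in the flag geometry of `PG(2, q)`: its points are the flags, its lines are the
points and the lines of `PG(2, q)`, and a flag is incident with its two elements. -/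
def flagIncident (f : Flag F) : ℙ F (Fin 3 → F) ⊕ PlaneLine F → Prop
  | Sum.inl p => f.1.1 = p
  | Sum.inr ℓ => f.1.2 = ℓ

end FlagGeometry

section Hexagon

variable (F : Type*) [Field F]

/-- The underlying vector space of the hyperplane `Π : X₁ + X₅ + X₉ = 0` of `PG(8, q)`, whose
points are the `3 × 3` matrices up to scalars. -/
abbrev TraceZero : Submodule F (Matrix (Fin 3) (Fin 3) F) :=
  LinearMap.ker (Matrix.traceLinearMap (Fin 3) F F)

/-- The form `X₂X₄ - X₁X₅ + X₃X₇ - X₁X₉ + X₆X₈ - X₅X₉` of the parabolic quadric `Q(8, q)`; the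
coordinates `X₁, …, X₉` are the matrix entries, row by row. -/
def form8 : QuadraticForm F (Matrix (Fin 3) (Fin 3) F) :=
  let X (i j : Fin 3) := Matrix.entryLinearMap F F i j
  QuadraticMap.linMulLin (X 0 1) (X 1 0) - QuadraticMap.linMulLin (X 0 0) (X 1 1)
    + QuadraticMap.linMulLin (X 0 2) (X 2 0) - QuadraticMap.linMulLin (X 0 0) (X 2 2)
    + QuadraticMap.linMulLin (X 1 2) (X 2 1) - QuadraticMap.linMulLin (X 1 1) (X 2 2)

/-- The form of the quadric `Q(8, q) ∩ Π` of `Π = PG(7, q)`. -/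
def form7 : QuadraticForm F (TraceZero F) :=
  (form8 F).comp (TraceZero F).subtype

/-- The Segre variety `S_{2,2}`: the points `(aᵢ bⱼ)` with `a ≠ 0` and `b ≠ 0`. -/
def segre : Set (ℙ F (Matrix (Fin 3) (Fin 3) F)) :=
  {P | ∃ a b : Fin 3 → F, a ≠ 0 ∧ b ≠ 0 ∧ P.submodule = Submodule.span F {Matrix.vecMulVec a b}}

/-- The points of the hexagon `Γ`: the points of `Π ∩ S_{2,2}`. -/
def hexPoints : Set (ℙ F (TraceZero F)) :=
  {x | x.map (TraceZero F).subtype (TraceZero F).injective_subtype ∈ segre F}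

/-- The lines of the hexagon `Γ`: the lines of `Π` contained in `Π ∩ S_{2,2}`. -/
def hexLines : Set (Submodule F (TraceZero F)) :=
  {ℓ | Module.finrank F ℓ = 2 ∧ ∀ x : ℙ F (TraceZero F), x.submodule ≤ ℓ → x ∈ hexPoints F}

variable {F} in
/-- The lines of `Γ` through the point `x`. -/
def hexLinesThrough (x : ℙ F (TraceZero F)) : Set (Submodule F (TraceZero F)) :=
  {ℓ | ℓ ∈ hexLines F ∧ x.submodule ≤ ℓ}

variable {F} in
/-- The subspace `π_x` spanned by the lines of `Γ` through `x`. -/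
def hexPlane (x : ℙ F (TraceZero F)) : Submodule F (TraceZero F) :=
  sSup (hexLinesThrough x)

/-- The set `𝒪 = ⋃ π_x`, the union being over all points `x` of `Γ`. -/
def ovoidSet : Set (ℙ F (TraceZero F)) :=
  {P | ∃ x ∈ hexPoints F, P.submodule ≤ hexPlane x}

end Hexagon

section GroupAction

variable (F : Type*) [Field F]

/-- `PGL(3, q)`, the quotient of `GL(3, q)` by its center. -/
abbrev PGL3 : Type _ := GL (Fin 3) F ⧸ Subgroup.center (GL (Fin 3) F)

/-- `GL(3, q)` acts linearly on the trace-zero matrices by `M ↦ A M A⁻¹`. -/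
def conjHom : GL (Fin 3) F →* Module.End F (TraceZero F) where
  toFun A :=
    { toFun := fun M => ⟨A.1 * M.1 * (A⁻¹).1, by
        have h := M.2
        simp only [LinearMap.mem_ker, Matrix.traceLinearMap_apply] at h ⊢
        rw [Matrix.trace_mul_comm, ← mul_assoc]
        simpa using h⟩
      map_add' := fun M N => Subtype.ext (by simp [mul_add, add_mul])
      map_smul' := fun c M => Subtype.ext (by simp) }
  map_one' := by
    ext1 M
    exact Subtype.ext (by simp)
  map_mul' A B := by
    ext1 M
    exact Subtype.ext (by simp [mul_assoc])

/-- The induced action of `GL(3, q)` on the points of `Π = PG(7, q)`. -/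
def conjPerm : GL (Fin 3) F →* Equiv.Perm (ℙ F (TraceZero F)) :=
  (MulAction.toPermHom (LinearMap.GeneralLinearGroup F (TraceZero F)) (ℙ F (TraceZero F))).comp
    (conjHom F).toHomUnits

theorem conjPerm_eq_one_of_mem_center (A : GL (Fin 3) F)
    (hA : A ∈ Subgroup.center (GL (Fin 3) F)) : conjPerm F A = 1 := by
  have h1 : conjHom F A = 1 := by
    obtain ⟨a, ha⟩ := Matrix.GeneralLinearGroup.mem_center_iff_val_mem_range_scalar.mp hA
    ext1 M
    refine Subtype.ext ?_
    change A.1 * M.1 * (A⁻¹).1 = M.1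
    have hc : A.1 * M.1 = M.1 * A.1 := by
      rw [← ha]
      exact Matrix.scalar_commute a (fun _ => Commute.all _ _) M.1
    rw [hc, mul_assoc]
    simp
  have h2 : (conjHom F).toHomUnits A = 1 := Units.ext h1
  rw [conjPerm, MonoidHom.comp_apply, h2, map_one]

/-- The action of `PGL(3, q)` on the points of `Π = PG(7, q)` induced by `M ↦ A M A⁻¹`. -/
def pglPerm : PGL3 F →* Equiv.Perm (ℙ F (TraceZero F)) :=
  QuotientGroup.lift (Subgroup.center (GL (Fin 3) F)) (conjPerm F)
    (conjPerm_eq_one_of_mem_center F)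

end GroupAction

end

end ThinHexagon

/-! On trace-zero matrices the quadratic form is minus the second coefficient of the characteristic
polynomial and its polar form is `tr (M N)`. So a quadric matrix has characteristic polynomial `X³ -
det M`, and the singular ones are exactly the nilpotent matrices. All the objects involved are
invariant under conjugation.

A point of `Γ` is an outer product `a bᵀ` with `a ⬝ b = 0`, that is, the flag formed by the point
`a` and the line `b ⬝ v = 0`. A line of `Γ` fixes one of the two factors, because two outer products
whose sum is again an outer product have proportional left or right factors
(`proportional_of_vecMulVec_add`). The plane of the flag `(a, b)` consists of the trace-zero
matrices `a b'ᵀ + a' bᵀ` with `a ⬝ b' = a' ⬝ b = 0`, which are nilpotent. Conversely a nilpotent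
matrix either has square zero, and is then an outer product, or is conjugate to the Jordan block `e₁
e₂ᵀ + e₂ e₃ᵀ`. So `𝒪` is the set of nilpotent points (`mk_mem_ovoidSet`).

The ovoid property asks for the number of nilpotent `N` with `tr (M N) = 0`. For nonzero nilpotent
`N`, the weighted count `#{a ≠ 0 : N a = 0} - q #{a ≠ 0 : N = a bᵀ for some b}` equals `q - 1`,
whatever the rank of `N` (`card_ker_sub_card_left_factor`). Summing over `N` turns the problem into
one for each fixed vector `a` (`sum_kernelCount_sub`). After moving `a` to `e₁` this concerns
nilpotent `2 × 2` blocks orthogonal to a block of `M`, a conic met by a line. If `det M ≠ 0` and `a`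
is an eigenvector, the remaining eigenvalues `ωλ`, `ω²λ` are distinct, the line is a secant, and
every `a` contributes the same amount. If `M` is nilpotent, the corrections for special `a` are
again governed by the weighted count, now of `M` itself. The totals are `q⁵ + q³ - q²` and `q⁵`.

The congruence `q ≡ 1 (mod 3)` enters only through the primitive cube root `ω`, which splits the
diagonal part of the form (hyperbolicity) and supplies the eigenvalues above. -/

namespace ThinHexagon

open Matrix

/-! ### Quadric matrices, nilpotency and conjugation -/

section Nilpotent

variable {F : Type*} [Field F]

theorem form8_apply (M : Matrix (Fin 3) (Fin 3) F) :
    form8 F M = M 0 1 * M 1 0 - M 0 0 * M 1 1 + M 0 2 * M 2 0 - M 0 0 * M 2 2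
      + M 1 2 * M 2 1 - M 1 1 * M 2 2 := by
  simp [form8]

/-- Makes the form visibly a conjugation invariant: the trace of the adjugate is the sum of the
principal `2 × 2` minors. -/
theorem form8_eq_neg_trace_adjugate (M : Matrix (Fin 3) (Fin 3) F) :
    form8 F M = -M.adjugate.trace := by
  rw [form8_apply, adjugate_fin_three, trace_fin_three]
  simp
  ring

/-- On trace-zero matrices the polar form of `form8` is the trace form. -/
theorem polar_form8 {M : Matrix (Fin 3) (Fin 3) F} (hM : M.trace = 0)
    (N : Matrix (Fin 3) (Fin 3) F) :
    QuadraticMap.polar (form8 F) M N = (M * N).trace := by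
  rw [trace_fin_three] at hM
  simp only [QuadraticMap.polar, form8_apply, Matrix.add_apply, trace_fin_three, mul_apply,
    Fin.sum_univ_three]
  linear_combination (-(N 0 0 + N 1 1 + N 2 2)) * hM

/-- The conditions `tr M = 0`, `Q M = 0`, which say that the characteristic polynomial of `M` is
`X ^ 3 - det M`. -/
def IsQuadricMatrix (M : Matrix (Fin 3) (Fin 3) F) : Prop :=
  M.trace = 0 ∧ form8 F M = 0

/-- Quadric matrices that are singular, that is, the nilpotent `3 × 3` matrices. -/
def IsNil (M : Matrix (Fin 3) (Fin 3) F) : Prop :=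
  IsQuadricMatrix M ∧ M.det = 0

theorem form8_conj (A : GL (Fin 3) F) (M : Matrix (Fin 3) (Fin 3) F) :
    form8 F (A.1 * M * (A⁻¹).1) = form8 F M := by
  rw [form8_eq_neg_trace_adjugate, form8_eq_neg_trace_adjugate, adjugate_mul_distrib,
    adjugate_mul_distrib, ← mul_assoc, trace_mul_comm, ← mul_assoc, ← adjugate_mul_distrib]
  simp

theorem trace_conj (A : GL (Fin 3) F) (M : Matrix (Fin 3) (Fin 3) F) :
    (A.1 * M * (A⁻¹).1).trace = M.trace := by
  rw [trace_mul_comm, ← mul_assoc]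
  simp

theorem det_conj (A : GL (Fin 3) F) (M : Matrix (Fin 3) (Fin 3) F) :
    (A.1 * M * (A⁻¹).1).det = M.det := by
  rw [det_mul_comm, ← mul_assoc]
  simp

theorem conj_mul_conj (A : GL (Fin 3) F) (M N : Matrix (Fin 3) (Fin 3) F) :
    (A.1 * M * (A⁻¹).1) * (A.1 * N * (A⁻¹).1) = A.1 * (M * N) * (A⁻¹).1 := by
  have h : (A⁻¹).1 * A.1 = 1 := by simp
  calc _ = A.1 * M * ((A⁻¹).1 * A.1) * N * (A⁻¹).1 := by simp only [mul_assoc]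
    _ = _ := by rw [h]; simp only [mul_assoc, one_mul]

theorem isQuadricMatrix_conj (A : GL (Fin 3) F) {M : Matrix (Fin 3) (Fin 3) F} :
    IsQuadricMatrix (A.1 * M * (A⁻¹).1) ↔ IsQuadricMatrix M := by
  simp only [IsQuadricMatrix, trace_conj, form8_conj]

theorem isNil_conj (A : GL (Fin 3) F) {M : Matrix (Fin 3) (Fin 3) F} :
    IsNil (A.1 * M * (A⁻¹).1) ↔ IsNil M := by
  simp only [IsNil, isQuadricMatrix_conj, det_conj]

theorem conj_vecMulVec (A : GL (Fin 3) F) (a b : Fin 3 → F) :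
    A.1 * vecMulVec a b * (A⁻¹).1 = vecMulVec (A.1 *ᵥ a) (b ᵥ* (A⁻¹).1) := by
  rw [mul_vecMulVec, vecMulVec_mul]

/-- The conjugation action of an invertible matrix. -/
def conjEquiv (A : GL (Fin 3) F) : Matrix (Fin 3) (Fin 3) F ≃ Matrix (Fin 3) (Fin 3) F where
  toFun M := A.1 * M * (A⁻¹).1
  invFun M := (A⁻¹).1 * M * A.1
  left_inv M := by
    have h : (A⁻¹).1 * A.1 = 1 := by simp
    calc _ = ((A⁻¹).1 * A.1) * M * ((A⁻¹).1 * A.1) := by simp only [mul_assoc]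
      _ = M := by rw [h]; simp
  right_inv M := by
    have h : A.1 * (A⁻¹).1 = 1 := by simp
    calc _ = (A.1 * (A⁻¹).1) * M * (A.1 * (A⁻¹).1) := by simp only [mul_assoc]
      _ = M := by rw [h]; simp

/-- Cayley–Hamilton in the form `adj M = M² - (tr M) M + tr (adj M) I`, where the last two terms
vanish on the quadric. -/
theorem adjugate_eq_sq {M : Matrix (Fin 3) (Fin 3) F} (h : IsQuadricMatrix M) :
    M.adjugate = M * M := by
  obtain ⟨h1, h2⟩ := h
  rw [trace_fin_three] at h1
  rw [form8_apply] at h2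
  rw [adjugate_fin_three]
  ext i j
  rw [mul_apply, Fin.sum_univ_three]
  fin_cases i <;> fin_cases j <;> simp
  · linear_combination (-h2 - M 0 0 * h1)
  · linear_combination - M 0 1 * h1
  · linear_combination - M 0 2 * h1
  · linear_combination - M 1 0 * h1
  · linear_combination (-h2 - M 1 1 * h1)
  · linear_combination - M 1 2 * h1
  · linear_combination - M 2 0 * h1
  · linear_combination - M 2 1 * h1
  · linear_combination (-h2 - M 2 2 * h1)

theorem IsNil.mul_sq {M : Matrix (Fin 3) (Fin 3) F} (h : IsNil M) : M * (M * M) = 0 := by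
  rw [← adjugate_eq_sq h.1, mul_adjugate, h.2, zero_smul]

/-- A matrix all of whose `2 × 2` minors vanish is an outer product. -/
theorem exists_eq_vecMulVec {m n : Type*} (M : Matrix m n F)
    (h : ∀ i j k l, M i j * M k l = M i l * M k j) : ∃ a b, M = vecMulVec a b := by
  by_cases h0 : M = 0
  · exact ⟨0, 0, by simp [h0]⟩
  · obtain ⟨i, j, hij⟩ : ∃ i j, M i j ≠ 0 := by
      by_contra! hc
      exact h0 (by ext i j; exact hc i j)
    refine ⟨fun k => M k j, fun l => M i l / M i j, ?_⟩
    ext k l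
    rw [vecMulVec_apply]
    field_simp
    linear_combination h k l i j

set_option maxHeartbeats 1000000 in
-- Since `M²` is the adjugate, `M² = 0` says that all `2 × 2` minors vanish.
theorem IsNil.exists_eq_vecMulVec {M : Matrix (Fin 3) (Fin 3) F} (h : IsNil M)
    (h2 : M * M = 0) : ∃ a b, M = vecMulVec a b := by
  apply ThinHexagon.exists_eq_vecMulVec
  rw [← adjugate_eq_sq h.1, adjugate_fin_three] at h2
  have e := fun i j => congrFun (congrFun h2 i) j
  have e00 := e 0 0
  have e01 := e 0 1
  have e02 := e 0 2
  have e10 := e 1 0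
  have e11 := e 1 1
  have e12 := e 1 2
  have e20 := e 2 0
  have e21 := e 2 1
  have e22 := e 2 2
  simp at e00 e01 e02 e10 e11 e12 e20 e21 e22
  intro i j k l
  fin_cases i <;> fin_cases j <;> fin_cases k <;> fin_cases l <;> simp only [Fin.zero_eta,
    Fin.mk_one, Fin.reduceFinMk] <;> first
    | ring1
    | linear_combination e00
    | linear_combination e01
    | linear_combination e02
    | linear_combination e10
    | linear_combination e11
    | linear_combination e12
    | linear_combination e20
    | linear_combination e21
    | linear_combination e22
    | linear_combination -e00
    | linear_combination -e01
    | linear_combination -e02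
    | linear_combination -e10
    | linear_combination -e11
    | linear_combination -e12
    | linear_combination -e20
    | linear_combination -e21
    | linear_combination -e22

/-- The regular nilpotent Jordan block. -/
def jordan : Matrix (Fin 3) (Fin 3) F := !![0, 1, 0; 0, 0, 1; 0, 0, 0]

/-- Any `v` with `M² v ≠ 0` is cyclic; the conjugating matrix has columns `M² v`, `M v`, `v`, and
independence follows by applying `M` repeatedly to a relation. -/
theorem exists_conj_jordan {M : Matrix (Fin 3) (Fin 3) F} (h3 : M * (M * M) = 0)
    (h2 : M * M ≠ 0) : ∃ A : GL (Fin 3) F, M = A.1 * jordan * (A⁻¹).1 := by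
  obtain ⟨v, hv⟩ : ∃ v, (M * M) *ᵥ v ≠ 0 := by
    by_contra! hc
    exact h2 (Matrix.ext_of_mulVec_single fun i => by rw [hc, zero_mulVec])
  set g : Matrix (Fin 3) (Fin 3) F := (Matrix.of ![(M * M) *ᵥ v, M *ᵥ v, v])ᵀ with hg
  have hgm : ∀ x : Fin 3 → F,
      g *ᵥ x = x 0 • ((M * M) *ᵥ v) + x 1 • (M *ᵥ v) + x 2 • v := by
    intro x
    ext i
    generalize (M * M) *ᵥ v = u at *
    generalize M *ᵥ v = w at *
    simp only [hg, mulVec, dotProduct, Fin.sum_univ_three, transpose_apply, of_apply, Pi.add_apply,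
      Pi.smul_apply, smul_eq_mul]
    simp [mul_comm]
  have hM3 : M *ᵥ ((M * M) *ᵥ v) = 0 := by rw [mulVec_mulVec, h3, zero_mulVec]
  have hM2 : M *ᵥ (M *ᵥ v) = (M * M) *ᵥ v := by rw [mulVec_mulVec]
  have hinj : ∀ x, g *ᵥ x = 0 → x = 0 := by
    intro x hx
    rw [hgm] at hx
    have k1 : x 1 • ((M * M) *ᵥ v) + x 2 • (M *ᵥ v) = 0 := by
      have := congrArg (fun y => M *ᵥ y) hx
      simpa [mulVec_add, mulVec_smul, hM3, hM2] using this
    have k2 : x 2 • ((M * M) *ᵥ v) = 0 := by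
      have := congrArg (fun y => M *ᵥ y) k1
      simpa only [mulVec_add, mulVec_smul, hM3, hM2, smul_zero, zero_add, mulVec_zero] using this
    have x2 : x 2 = 0 := (smul_eq_zero.mp k2).resolve_right hv
    rw [x2, zero_smul, add_zero] at k1
    have x1 : x 1 = 0 := (smul_eq_zero.mp k1).resolve_right hv
    rw [x1, x2, zero_smul, zero_smul, add_zero, add_zero] at hx
    have x0 : x 0 = 0 := (smul_eq_zero.mp hx).resolve_right hv
    ext i
    fin_cases i <;> simp [x0, x1, x2]
  have hdet : IsUnit g.det := by
    rw [isUnit_iff_ne_zero]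
    intro h0
    obtain ⟨x, hx, hx0⟩ := exists_mulVec_eq_zero_iff.mpr h0
    exact hx (hinj x hx0)
  let A : GL (Fin 3) F := Matrix.nonsingInvUnit g hdet
  have hA : A.1 = g := rfl
  have hcomm : M * A.1 = A.1 * jordan := by
    apply Matrix.ext_of_mulVec_single
    intro i
    rw [hA, ← mulVec_mulVec, ← mulVec_mulVec, hgm, hgm]
    fin_cases i <;>
      simp [jordan, hM3, hM2, mulVec, dotProduct, Fin.sum_univ_three]
  refine ⟨A, ?_⟩
  rw [← hcomm, mul_assoc]
  simp

/-- A vector in `F ^ 3` different from zero is the first column of an invertible matrix. -/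
theorem exists_mulVec_single_eq {a : Fin 3 → F} (ha : a ≠ 0) :
    ∃ A : GL (Fin 3) F, A.1 *ᵥ Pi.single 0 1 = a := by
  obtain ⟨g, hg⟩ : ∃ g : Matrix (Fin 3) (Fin 3) F, g.det ≠ 0 ∧ g *ᵥ Pi.single 0 1 = a := by
    obtain ⟨i, hi⟩ := Function.ne_iff.mp ha
    fin_cases i
    · refine ⟨!![a 0, 0, 0; a 1, 1, 0; a 2, 0, 1], ?_, ?_⟩
      · simpa [det_fin_three] using hi
      · ext j; fin_cases j <;> simp
    · refine ⟨!![a 0, 1, 0; a 1, 0, 0; a 2, 0, 1], ?_, ?_⟩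
      · simpa [det_fin_three] using hi
      · ext j; fin_cases j <;> simp
    · refine ⟨!![a 0, 1, 0; a 1, 0, 1; a 2, 0, 0], ?_, ?_⟩
      · simpa [det_fin_three] using hi
      · ext j; fin_cases j <;> simp
  exact ⟨Matrix.nonsingInvUnit g (isUnit_iff_ne_zero.mpr hg.1), hg.2⟩

end Nilpotent

/-! ### Point counts for plane and conic equations -/

section Counting

theorem card_subtype_prod_of_fiber {X Y : Type*} [Finite X] [Finite Y] (P : Y → Prop)
    (R : X → Y → Prop) (n : ℕ) (h : ∀ y, P y → Nat.card {x // R x y} = n) :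
    Nat.card {p : X × Y // P p.2 ∧ R p.1 p.2} = Nat.card {y // P y} * n := by
  classical
  have := Fintype.ofFinite {y // P y}
  let e : {p : X × Y // P p.2 ∧ R p.1 p.2} ≃ Σ y : {y // P y}, {x // R x y.1} :=
    { toFun := fun p => ⟨⟨p.1.2, p.2.1⟩, ⟨p.1.1, p.2.2⟩⟩
      invFun := fun s => ⟨(s.2.1, s.1.1), s.1.2, s.2.2⟩
      left_inv := fun _ => rfl
      right_inv := fun _ => rfl }
  rw [Nat.card_congr e, Nat.card_sigma, Finset.sum_congr rfl fun y _ => h y.1 y.2]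
  simp

variable {F : Type*} [Field F]

theorem card_line (α β γ : F) (h : α ≠ 0 ∨ β ≠ 0) :
    Nat.card {p : F × F // α * p.1 + β * p.2 = γ} = Nat.card F := by
  rcases h with h | h
  · exact Nat.card_congr
      { toFun := fun p => p.1.2
        invFun := fun y => ⟨((γ - β * y) / α, y), by field_simp; ring⟩
        left_inv := fun ⟨⟨x, y⟩, hp⟩ => by
          refine Subtype.ext (Prod.ext ?_ rfl)
          simp only at hp ⊢
          rw [div_eq_iff h]
          linear_combination -hp
        right_inv := fun _ => rfl }
  · exact Nat.card_congr
      { toFun := fun p => p.1.1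
        invFun := fun x => ⟨(x, (γ - α * x) / β), by field_simp; ring⟩
        left_inv := fun ⟨⟨x, y⟩, hp⟩ => by
          refine Subtype.ext (Prod.ext rfl ?_)
          simp only at hp ⊢
          rw [div_eq_iff h]
          linear_combination -hp
        right_inv := fun _ => rfl }

theorem card_cross [Finite F] :
    Nat.card {p : F × F // p.1 * p.2 = 0} = 2 * Nat.card F - 1 := by
  classical
  have h : {p : F × F | p.1 * p.2 = 0} = Set.range (fun x : F => (x, (0 : F))) ∪
      (fun y : F => ((0 : F), y)) '' {0}ᶜ := by
    ext ⟨x, y⟩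
    simp only [Set.mem_ofPred_eq, mul_eq_zero, Set.mem_union, Set.mem_range, Prod.mk.injEq,
      Set.mem_image, Set.mem_compl_iff, Set.mem_singleton_iff]
    constructor
    · rintro (rfl | rfl)
      · by_cases hy : y = 0
        · exact Or.inl ⟨0, rfl, hy.symm⟩
        · exact Or.inr ⟨y, hy, rfl, rfl⟩
      · exact Or.inl ⟨x, rfl, rfl⟩
    · rintro (⟨_, _, h⟩ | ⟨_, _, h, _⟩)
      · exact Or.inr h.symm
      · exact Or.inl h.symm
  change Nat.card ({p : F × F | p.1 * p.2 = 0} : Set (F × F)) = _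
  rw [Nat.card_coe_set_eq, h, Set.ncard_union_eq]
  · rw [Set.ncard_image_of_injective _ (fun _ _ h => (Prod.mk.inj h).2), Set.ncard_compl,
      Set.ncard_singleton, ← Set.image_univ,
      Set.ncard_image_of_injective _ (fun _ _ h => (Prod.mk.inj h).1), Set.ncard_univ]
    have : 0 < Nat.card F := Nat.card_pos
    omega
  · rw [Set.disjoint_left]
    rintro _ ⟨x, rfl⟩ ⟨y, hy, h⟩
    exact hy (Prod.mk.inj h).2

theorem card_cone :
    Nat.card {p : F × F × F // p.1 ^ 2 + p.2.1 * p.2.2 = 0} = Nat.card F ^ 2 := by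
  classical
  rw [sq, ← Nat.card_prod]
  -- For `t ≠ 0` the triple is determined by `t` and `s`; for `t = 0` the equation forces `s = 0`
  -- and leaves `u` free.
  refine Nat.card_congr
    { toFun := fun p => (p.1.2.1, if p.1.2.1 = 0 then p.1.2.2 else p.1.1)
      invFun := fun p => if h : p.1 = 0 then ⟨(0, 0, p.2), by simp⟩ else
        ⟨(p.2, p.1, -p.2 ^ 2 / p.1), by field_simp; ring⟩
      left_inv := ?_
      right_inv := ?_ }
  · rintro ⟨⟨s, t, u⟩, hp⟩
    simp only at hp
    by_cases ht : t = 0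
    · subst ht
      have hs : s = 0 := by simpa using hp
      simp [hs]
    · simp only [ht, dite_false, if_false]
      refine Subtype.ext (Prod.ext rfl (Prod.ext rfl ?_))
      simp only
      rw [div_eq_iff ht]
      linear_combination -hp
  · rintro ⟨t, x⟩
    by_cases ht : t = 0
    · subst ht
      simp
    · simp [ht]

/-- The isotropic vectors of `s ^ 2 + t u` on the plane `α s + β t + γ u = 0`, when the restricted
form splits into two distinct linear factors. -/
theorem card_conic_secant [Finite F] {α β γ w₁ w₂ : F} (ha : w₁ + w₂ = α) (hb : w₁ * w₂ = -(β * γ))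
    (hw : w₁ ≠ w₂) :
    Nat.card {p : F × F × F // p.1 ^ 2 + p.2.1 * p.2.2 = 0 ∧
      α * p.1 + β * p.2.1 + γ * p.2.2 = 0} = 2 * Nat.card F - 1 := by
  have hw' : w₁ - w₂ ≠ 0 := sub_ne_zero.mpr hw
  rw [← card_cross]
  subst ha
  -- When `γ ≠ 0`, eliminating `u` gives `γ² (s² + t u) = (γ s - w₁ t) (γ s - w₂ t)`; the two
  -- factors are new coordinates because `w₁ ≠ w₂`. The case `β ≠ 0` is the same with `t` and `u`
  -- exchanged. If both vanish then `α ≠ 0`, so `s = 0` and `t u = 0` remains.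
  by_cases hβ : β = 0
  · by_cases hγ : γ = 0
    · subst hβ hγ
      have hα : w₁ + w₂ ≠ 0 := by
        rcases mul_eq_zero.mp (show w₁ * w₂ = 0 by simpa using hb) with h | h
        · subst h; simpa using hw.symm
        · subst h; simpa using hw
      refine Nat.card_congr
        { toFun := fun p => ⟨p.1.2, ?_⟩
          invFun := fun p => ⟨(0, p.1), ?_⟩
          left_inv := ?_
          right_inv := fun _ => rfl }
      · obtain ⟨⟨s, t, u⟩, h1, h2⟩ := p
        have hs : s = 0 := by simpa [hα] using h2
        simpa [hs] using h1
      · simpa using p.2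
      · rintro ⟨⟨s, t, u⟩, h1, h2⟩
        have hs : s = 0 := by simpa [hα] using h2
        exact Subtype.ext (Prod.ext hs.symm rfl)
    · refine Nat.card_congr
        { toFun := fun p => ⟨(γ * p.1.1 - w₁ * p.1.2.1, γ * p.1.1 - w₂ * p.1.2.1), ?_⟩
          invFun := fun p =>
            ⟨((w₁ * p.1.2 - w₂ * p.1.1) / (γ * (w₁ - w₂)), (p.1.2 - p.1.1) / (w₁ - w₂),
              -((w₁ + w₂) * ((w₁ * p.1.2 - w₂ * p.1.1) / (γ * (w₁ - w₂)))
                + β * ((p.1.2 - p.1.1) / (w₁ - w₂))) / γ), ?_, ?_⟩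
          left_inv := ?_
          right_inv := ?_ }
      · obtain ⟨⟨s, t, u⟩, h1, h2⟩ := p
        simp only at h1 h2 ⊢
        linear_combination γ ^ 2 * h1 - γ * t * h2 + t ^ 2 * hb
      · obtain ⟨⟨x, y⟩, h⟩ := p
        simp only at h ⊢
        field_simp
        linear_combination (w₁ - w₂) ^ 2 * h - (y - x) ^ 2 * hb
      · field_simp
        ring
      · rintro ⟨⟨s, t, u⟩, h1, h2⟩
        simp only at h1 h2
        refine Subtype.ext (Prod.ext ?_ (Prod.ext ?_ ?_)) <;> simp only <;> field_simp
        · ring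
        · ring
        · linear_combination -(w₁ - w₂) * γ * h2
      · rintro ⟨⟨x, y⟩, h⟩
        refine Subtype.ext (Prod.ext ?_ ?_) <;> simp only <;> field_simp <;> ring
  · refine Nat.card_congr
      { toFun := fun p => ⟨(β * p.1.1 - w₁ * p.1.2.2, β * p.1.1 - w₂ * p.1.2.2), ?_⟩
        invFun := fun p =>
          ⟨((w₁ * p.1.2 - w₂ * p.1.1) / (β * (w₁ - w₂)),
            -((w₁ + w₂) * ((w₁ * p.1.2 - w₂ * p.1.1) / (β * (w₁ - w₂)))
              + γ * ((p.1.2 - p.1.1) / (w₁ - w₂))) / β, (p.1.2 - p.1.1) / (w₁ - w₂)), ?_, ?_⟩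
        left_inv := ?_
        right_inv := ?_ }
    · obtain ⟨⟨s, t, u⟩, h1, h2⟩ := p
      simp only at h1 h2 ⊢
      linear_combination β ^ 2 * h1 - β * u * h2 + u ^ 2 * hb
    · obtain ⟨⟨x, y⟩, h⟩ := p
      simp only at h ⊢
      field_simp
      linear_combination (w₁ - w₂) ^ 2 * h - (y - x) ^ 2 * hb
    · field_simp
      ring
    · rintro ⟨⟨s, t, u⟩, h1, h2⟩
      simp only at h1 h2
      refine Subtype.ext (Prod.ext ?_ (Prod.ext ?_ ?_)) <;> simp only <;> field_simp
      · ring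
      · linear_combination -(w₁ - w₂) * β * h2
      · ring
    · rintro ⟨⟨x, y⟩, h⟩
      refine Subtype.ext (Prod.ext ?_ ?_) <;> simp only <;> field_simp <;> ring

/-- The isotropic vectors of `s ^ 2 + t u` on the plane `α s + β t + γ u = 0`, when the restricted
form is the square of a nonzero linear form. -/
theorem card_conic_tangent {α β γ w : F} (ha : w + w = α) (hb : w * w = -(β * γ))
    (h0 : β ≠ 0 ∨ γ ≠ 0) :
    Nat.card {p : F × F × F // p.1 ^ 2 + p.2.1 * p.2.2 = 0 ∧
      α * p.1 + β * p.2.1 + γ * p.2.2 = 0} = Nat.card F := by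
  subst ha
  rcases h0 with h | h
  · refine Nat.card_congr
      { toFun := fun p => p.1.2.2
        invFun := fun u => ⟨(w * u / β, -((w + w) * (w * u / β) + γ * u) / β, u), ?_, ?_⟩
        left_inv := ?_
        right_inv := fun _ => rfl }
    · field_simp
      linear_combination -u ^ 2 * hb
    · field_simp
      ring
    · rintro ⟨⟨s, t, u⟩, h1, h2⟩
      simp only at h1 h2
      -- With a double root, `β² (s² + t u)` is the square of this linear form on the plane, so the
      -- solutions form a line.
      have hs : β * s - w * u = 0 := by
        refine pow_eq_zero_iff two_ne_zero |>.mp ?_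
        linear_combination β ^ 2 * h1 - β * u * h2 + u ^ 2 * hb
      have hs' : w * u / β = s := by rw [div_eq_iff h]; linear_combination -hs
      refine Subtype.ext (Prod.ext hs' (Prod.ext ?_ rfl))
      simp only
      rw [hs', div_eq_iff h]
      linear_combination -h2
  · refine Nat.card_congr
      { toFun := fun p => p.1.2.1
        invFun := fun t => ⟨(w * t / γ, t, -((w + w) * (w * t / γ) + β * t) / γ), ?_, ?_⟩
        left_inv := ?_
        right_inv := fun _ => rfl }
    · field_simp
      linear_combination -t ^ 2 * hb
    · field_simp
      ring
    · rintro ⟨⟨s, t, u⟩, h1, h2⟩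
      simp only at h1 h2
      have hs : γ * s - w * t = 0 := by
        refine pow_eq_zero_iff two_ne_zero |>.mp ?_
        linear_combination γ ^ 2 * h1 - γ * t * h2 + t ^ 2 * hb
      have hs' : w * t / γ = s := by rw [div_eq_iff h]; linear_combination -hs
      refine Subtype.ext (Prod.ext hs' (Prod.ext rfl ?_))
      simp only
      rw [hs', div_eq_iff h]
      linear_combination -h2

end Counting

/-! ### Orthogonal nilpotent matrices with a prescribed vector in the kernel or spanning the image
-/

section NilpotentCount

variable {F : Type*} [Field F]

/-- The number of nilpotent matrices orthogonal to `M` for the trace form and annihilating `a`. -/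
noncomputable def kernelCount (M : Matrix (Fin 3) (Fin 3) F) (a : Fin 3 → F) : ℕ :=
  Nat.card {N : Matrix (Fin 3) (Fin 3) F // (IsNil N ∧ (M * N).trace = 0) ∧ N *ᵥ a = 0}

/-- The number of nilpotent matrices orthogonal to `M` for the trace form and with range in the
span of `a`. -/
noncomputable def imageCount (M : Matrix (Fin 3) (Fin 3) F) (a : Fin 3 → F) : ℕ :=
  Nat.card {N : Matrix (Fin 3) (Fin 3) F // (IsNil N ∧ (M * N).trace = 0) ∧
    ∃ b, N = vecMulVec a b}

theorem conj_mulVec_mulVec (A : GL (Fin 3) F) (N : Matrix (Fin 3) (Fin 3) F) (a : Fin 3 → F) :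
    (A.1 * N * (A⁻¹).1) *ᵥ (A.1 *ᵥ a) = A.1 *ᵥ (N *ᵥ a) := by
  have h : (A⁻¹).1 * A.1 = 1 := by simp
  rw [mulVec_mulVec, mul_assoc, h, mul_one, ← mulVec_mulVec]

theorem mulVec_eq_zero_iff_of_unit (A : GL (Fin 3) F) {a : Fin 3 → F} :
    A.1 *ᵥ a = 0 ↔ a = 0 := by
  refine ⟨fun h => ?_, fun h => by rw [h, mulVec_zero]⟩
  have : (A⁻¹).1 *ᵥ (A.1 *ᵥ a) = a := by
    rw [mulVec_mulVec]
    simp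
  rw [← this, h, mulVec_zero]

theorem exists_conj_eq_vecMulVec_iff (A : GL (Fin 3) F) {N : Matrix (Fin 3) (Fin 3) F}
    {a : Fin 3 → F} :
    (∃ b, A.1 * N * (A⁻¹).1 = vecMulVec (A.1 *ᵥ a) b) ↔ ∃ b, N = vecMulVec a b := by
  constructor
  · rintro ⟨b, hb⟩
    refine ⟨b ᵥ* A.1, (conjEquiv A).injective ?_⟩
    change A.1 * N * (A⁻¹).1 = A.1 * _ * (A⁻¹).1
    rw [conj_vecMulVec, hb, vecMul_vecMul]
    simp
  · rintro ⟨b, rfl⟩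
    exact ⟨_, conj_vecMulVec A a b⟩

theorem kernelCount_conj (A : GL (Fin 3) F) (M : Matrix (Fin 3) (Fin 3) F) (a : Fin 3 → F) :
    kernelCount (A.1 * M * (A⁻¹).1) (A.1 *ᵥ a) = kernelCount M a := by
  refine (Nat.card_congr ((conjEquiv A).subtypeEquiv fun N => ?_)).symm
  change _ ↔ (IsNil (A.1 * N * (A⁻¹).1) ∧ ((A.1 * M * (A⁻¹).1) * (A.1 * N * (A⁻¹).1)).trace = 0) ∧
    (A.1 * N * (A⁻¹).1) *ᵥ (A.1 *ᵥ a) = 0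
  rw [isNil_conj, conj_mul_conj, trace_conj, conj_mulVec_mulVec, mulVec_eq_zero_iff_of_unit]

theorem imageCount_conj (A : GL (Fin 3) F) (M : Matrix (Fin 3) (Fin 3) F) (a : Fin 3 → F) :
    imageCount (A.1 * M * (A⁻¹).1) (A.1 *ᵥ a) = imageCount M a := by
  refine (Nat.card_congr ((conjEquiv A).subtypeEquiv fun N => ?_)).symm
  change _ ↔ (IsNil (A.1 * N * (A⁻¹).1) ∧ ((A.1 * M * (A⁻¹).1) * (A.1 * N * (A⁻¹).1)).trace = 0) ∧
    ∃ b, A.1 * N * (A⁻¹).1 = vecMulVec (A.1 *ᵥ a) b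
  rw [isNil_conj, conj_mul_conj, trace_conj, exists_conj_eq_vecMulVec_iff]

/-- A nilpotent matrix killing `e₁` is a free top row `(0, x, y)` over a trace-zero block with
entries `s`, `t`, `u`, `-s`, and the block is nilpotent exactly when `s² + t u = 0`. -/
theorem kernelCount_single (M : Matrix (Fin 3) (Fin 3) F) :
    kernelCount M (Pi.single 0 1) = Nat.card {p : (F × F) × (F × F × F) //
      p.2.1 ^ 2 + p.2.2.1 * p.2.2.2 = 0 ∧ M 1 0 * p.1.1 + M 2 0 * p.1.2 =
        -((M 1 1 - M 2 2) * p.2.1 + M 2 1 * p.2.2.1 + M 1 2 * p.2.2.2)} := by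
  refine Nat.card_congr
    { toFun := fun N => ⟨((N.1 0 1, N.1 0 2), (N.1 1 1, N.1 1 2, N.1 2 1)), ?_⟩
      invFun := fun p => ⟨!![0, p.1.1.1, p.1.1.2; 0, p.1.2.1, p.1.2.2.1; 0, p.1.2.2.2, -p.1.2.1],
        ⟨⟨⟨?_, ?_⟩, ?_⟩, ?_⟩, ?_⟩
      left_inv := ?_
      right_inv := fun _ => rfl }
  · obtain ⟨N, ⟨⟨⟨h1, h2⟩, h3⟩, h4⟩, h5⟩ := N
    rw [mulVec_single_one] at h5
    have c0 : N 0 0 = 0 := congrFun h5 0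
    have c1 : N 1 0 = 0 := congrFun h5 1
    have c2 : N 2 0 = 0 := congrFun h5 2
    simp only [trace_fin_three, mul_apply, Fin.sum_univ_three, form8_apply, c0, c1, c2] at h1 h2 h4
    have h22 : N 2 2 = - N 1 1 := by linear_combination h1
    rw [h22] at h2 h4
    constructor
    · simp only
      linear_combination h2
    · simp only
      linear_combination h4
  · simp [trace_fin_three]
  · rw [form8_apply]
    simp
    linear_combination p.2.1
  · simp [det_fin_three]
  · simp [trace_fin_three, mul_apply, Fin.sum_univ_three]
    linear_combination p.2.2
  · ext i
    fin_cases i <;> simp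
  · rintro ⟨N, ⟨⟨⟨h1, h2⟩, h3⟩, h4⟩, h5⟩
    rw [mulVec_single_one] at h5
    have c0 : N 0 0 = 0 := congrFun h5 0
    have c1 : N 1 0 = 0 := congrFun h5 1
    have c2 : N 2 0 = 0 := congrFun h5 2
    have h22 : -N 1 1 = N 2 2 := by
      rw [trace_fin_three, c0] at h1
      linear_combination -h1
    refine Subtype.ext ?_
    ext i j
    fin_cases i <;> fin_cases j <;> simp [c0, c1, c2, h22]

theorem imageCount_single (M : Matrix (Fin 3) (Fin 3) F) :
    imageCount M (Pi.single 0 1) =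
      Nat.card {p : F × F // M 1 0 * p.1 + M 2 0 * p.2 = 0} := by
  refine Nat.card_congr
    { toFun := fun N => ⟨(N.1 0 1, N.1 0 2), ?_⟩
      invFun := fun p => ⟨!![0, p.1.1, p.1.2; 0, 0, 0; 0, 0, 0],
        ⟨⟨⟨?_, ?_⟩, ?_⟩, ?_⟩, ![0, p.1.1, p.1.2], ?_⟩
      left_inv := ?_
      right_inv := fun _ => rfl }
  · obtain ⟨N, ⟨⟨⟨h1, h2⟩, h3⟩, h4⟩, b, rfl⟩ := N
    rw [trace_fin_three] at h1
    have hb : b 0 = 0 := by simpa [vecMulVec_apply] using h1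
    simpa [trace_fin_three, mul_apply, Fin.sum_univ_three, vecMulVec_apply, hb] using h4
  · simp [trace_fin_three]
  · simp [form8_apply]
  · simp [det_fin_three]
  · simpa [trace_fin_three, mul_apply, Fin.sum_univ_three] using p.2
  · ext i j
    fin_cases i <;> fin_cases j <;> simp [vecMulVec_apply]
  · rintro ⟨N, ⟨⟨⟨h1, h2⟩, h3⟩, h4⟩, b, rfl⟩
    rw [trace_fin_three] at h1
    have hb : b 0 = 0 := by simpa [vecMulVec_apply] using h1
    refine Subtype.ext ?_
    ext i j
    fin_cases i <;> fin_cases j <;> simp [vecMulVec_apply, hb]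

theorem imageCount_single_of_ne (M : Matrix (Fin 3) (Fin 3) F) (h : M 1 0 ≠ 0 ∨ M 2 0 ≠ 0) :
    imageCount M (Pi.single 0 1) = Nat.card F := by
  rw [imageCount_single, card_line _ _ _ h]

theorem imageCount_single_of_eq (M : Matrix (Fin 3) (Fin 3) F) (h₁ : M 1 0 = 0) (h₂ : M 2 0 = 0) :
    imageCount M (Pi.single 0 1) = Nat.card F ^ 2 := by
  rw [imageCount_single, h₁, h₂, sq, ← Nat.card_prod]
  exact Nat.card_congr (Equiv.subtypeUnivEquiv fun p => by simp)

theorem exists_conj_of_ne_zero (M : Matrix (Fin 3) (Fin 3) F) {a : Fin 3 → F} (ha : a ≠ 0) :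
    ∃ (A : GL (Fin 3) F) (M' : Matrix (Fin 3) (Fin 3) F),
      A.1 *ᵥ Pi.single 0 1 = a ∧ M = A.1 * M' * (A⁻¹).1 := by
  obtain ⟨A, hA⟩ := exists_mulVec_single_eq ha
  exact ⟨A, (conjEquiv A).symm M, hA, ((conjEquiv A).apply_symm_apply M).symm⟩

variable [Finite F]

/-- Here `e₁` is not an eigenvector of `M`: each of the `q²` nilpotent blocks leaves a nontrivial
linear equation on the top row, with `q` solutions. -/
theorem kernelCount_single_of_ne (M : Matrix (Fin 3) (Fin 3) F) (h : M 1 0 ≠ 0 ∨ M 2 0 ≠ 0) :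
    kernelCount M (Pi.single 0 1) = Nat.card F ^ 3 := by
  rw [kernelCount_single]
  refine (card_subtype_prod_of_fiber (fun p : F × F × F => p.1 ^ 2 + p.2.1 * p.2.2 = 0)
    (fun (x : F × F) y => M 1 0 * x.1 + M 2 0 * x.2 =
        -((M 1 1 - M 2 2) * y.1 + M 2 1 * y.2.1 + M 1 2 * y.2.2)) (Nat.card F)
    (fun y _ => card_line _ _ _ h)).trans ?_
  rw [card_cone]
  ring

/-- Here `e₁` is an eigenvector of `M`: orthogonality does not involve the top row and becomes a
linear condition on the block. -/
theorem kernelCount_single_of_eq (M : Matrix (Fin 3) (Fin 3) F) (h₁ : M 1 0 = 0) (h₂ : M 2 0 = 0) :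
    kernelCount M (Pi.single 0 1) = Nat.card {p : F × F × F // p.1 ^ 2 + p.2.1 * p.2.2 = 0 ∧
      (M 1 1 - M 2 2) * p.1 + M 2 1 * p.2.1 + M 1 2 * p.2.2 = 0} * Nat.card F ^ 2 := by
  rw [kernelCount_single, h₁, h₂, ← card_subtype_prod_of_fiber (X := F × F) _ (fun _ _ => True)]
  · refine Nat.card_congr (Equiv.subtypeEquivRight fun p => ?_)
    simp only [zero_mul, add_zero, and_true, eq_comm (a := (0 : F)), neg_eq_zero]
  · intro y _
    rw [sq, ← Nat.card_prod]
    exact Nat.card_congr (Equiv.subtypeUnivEquiv fun p => trivial)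

/-- Primitive cube roots of unity, as roots of `X ^ 2 + X + 1` in characteristic other than `3`. -/
def IsCubeRoot (ω : F) : Prop := ω ^ 2 + ω + 1 = 0 ∧ ω ≠ ω ^ 2

/-- The weight `q` makes the two cases agree: `q³ - q · q` when `e₁` is not an eigenvector, and `(2q
- 1) q² - q · q²` when it is. -/
theorem kernelCount_sub_single_of_det_ne_zero {ω : F} (hω : IsCubeRoot ω)
    {M : Matrix (Fin 3) (Fin 3) F} (hM : IsQuadricMatrix M) (hd : M.det ≠ 0) :
    (kernelCount M (Pi.single 0 1) : ℤ) - Nat.card F * imageCount M (Pi.single 0 1) =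
      Nat.card F ^ 3 - Nat.card F ^ 2 := by
  by_cases h : M 1 0 = 0 ∧ M 2 0 = 0
  · obtain ⟨h1, h2⟩ := h
    obtain ⟨ht, hf⟩ := hM
    rw [trace_fin_three] at ht
    rw [form8_apply, h1, h2] at hf
    rw [det_fin_three, h1, h2] at hd
    have h00 : M 0 0 ≠ 0 := by
      rintro h0
      apply hd
      rw [h0]
      ring
    -- The roots are `M 1 1 - μ` for the eigenvalues `μ` of the lower block, which are `ωλ` and
    -- `ω²λ` with `λ = M 0 0`, because the characteristic polynomial is `X³ - λ³`.
    have hcard := card_conic_secant (α := M 1 1 - M 2 2) (β := M 2 1) (γ := M 1 2)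
      (w₁ := M 1 1 - ω * M 0 0) (w₂ := M 1 1 - ω ^ 2 * M 0 0)
      (by linear_combination -M 0 0 * hω.1 + ht)
      (by linear_combination (M 0 0 ^ 2 * (ω - 1) - M 0 0 * M 1 1) * hω.1 + hf
            + (M 0 0 + M 1 1) * ht)
      (by
        intro hw
        apply hω.2
        apply mul_right_cancel₀ h00
        linear_combination -hw)
    rw [kernelCount_single_of_eq M h1 h2, imageCount_single_of_eq M h1 h2, hcard]
    have : 0 < Nat.card F := Nat.card_pos
    push_cast [Nat.cast_sub (show 1 ≤ 2 * Nat.card F by omega)]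
    ring
  · rw [not_and_or] at h
    rw [kernelCount_single_of_ne M h, imageCount_single_of_ne M h]
    push_cast
    ring

open Classical in
-- For nilpotent `M` an eigenvector lies in the kernel and the lower block is nilpotent. A nonzero
-- block gives a tangent line and `q · q² - q · q² = 0`; a zero block means that `M` has image in
-- the span of `e₁` and gives `q² · q² - q · q²`. The two indicators record these deviations from
-- `q³ - q²`.
theorem kernelCount_sub_single_of_det_eq_zero
    {M : Matrix (Fin 3) (Fin 3) F} (hM : IsNil M) :
    (kernelCount M (Pi.single 0 1) : ℤ) - Nat.card F * imageCount M (Pi.single 0 1) =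
      Nat.card F ^ 3 - Nat.card F ^ 2
      - (Nat.card F ^ 3 - Nat.card F ^ 2) * (if M *ᵥ Pi.single 0 1 = 0 then 1 else 0)
      + (Nat.card F ^ 4 - Nat.card F ^ 3) *
        (if ∃ b, M = vecMulVec (Pi.single 0 1) b then 1 else 0) := by
  obtain ⟨⟨ht, hf⟩, hd⟩ := hM
  by_cases h : M 1 0 = 0 ∧ M 2 0 = 0
  · obtain ⟨h1, h2⟩ := h
    rw [trace_fin_three] at ht
    rw [form8_apply, h1, h2] at hf
    rw [det_fin_three, h1, h2] at hd
    -- `M 0 0` is an eigenvalue, hence a root of `X³ - det M = X³`.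
    have h00 : M 0 0 = 0 := by
      refine pow_eq_zero_iff three_ne_zero |>.mp ?_
      linear_combination hd + M 0 0 * hf + M 0 0 ^ 2 * ht
    have hz : M *ᵥ Pi.single 0 1 = 0 := by
      rw [mulVec_single_one]
      ext i
      fin_cases i <;> simp [h00, h1, h2]
    rw [h00] at ht hf
    have h22 : M 2 2 = -M 1 1 := by linear_combination ht
    rw [h22] at hf
    rw [kernelCount_single_of_eq M h1 h2, imageCount_single_of_eq M h1 h2, if_pos hz]
    by_cases h' : M 2 1 = 0 ∧ M 1 2 = 0
    · obtain ⟨h3, h4⟩ := h'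
      have h11 : M 1 1 = 0 := by
        rw [h3, h4] at hf
        refine pow_eq_zero_iff two_ne_zero |>.mp ?_
        linear_combination hf
      rw [h11, neg_zero] at h22
      have hv : ∃ b, M = vecMulVec (Pi.single 0 1) b := by
        refine ⟨M 0, ?_⟩
        ext i j
        fin_cases i <;> fin_cases j <;> simp [vecMulVec_apply, h1, h2, h3, h4, h11, h22]
      rw [if_pos hv, h3, h4, h11, h22]
      simp only [sub_zero, zero_mul, add_zero, and_true]
      rw [card_cone]
      push_cast
      ring
    · have hv : ¬ ∃ b, M = vecMulVec (Pi.single 0 1) b := by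
        rintro ⟨b, hb⟩
        apply h'
        rw [hb]
        simp [vecMulVec_apply]
      rw [not_and_or] at h'
      rw [if_neg hv, card_conic_tangent (w := M 1 1) (by linear_combination h22)
        (by linear_combination hf) h']
      push_cast
      ring
  · have hz : M *ᵥ Pi.single 0 1 ≠ 0 := by
      intro hz
      rw [mulVec_single_one] at hz
      exact h ⟨congrFun hz 1, congrFun hz 2⟩
    have hv : ¬ ∃ b, M = vecMulVec (Pi.single 0 1) b := by
      rintro ⟨b, hb⟩
      apply h
      rw [hb]
      simp [vecMulVec_apply]
    rw [not_and_or] at h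
    rw [if_neg hz, if_neg hv, kernelCount_single_of_ne M h, imageCount_single_of_ne M h]
    push_cast
    ring

theorem kernelCount_sub_of_det_ne_zero {ω : F} (hω : IsCubeRoot ω)
    {M : Matrix (Fin 3) (Fin 3) F} (hM : IsQuadricMatrix M) (hd : M.det ≠ 0) {a : Fin 3 → F}
    (ha : a ≠ 0) :
    (kernelCount M a : ℤ) - Nat.card F * imageCount M a = Nat.card F ^ 3 - Nat.card F ^ 2 := by
  obtain ⟨A, M', rfl, rfl⟩ := exists_conj_of_ne_zero M ha
  rw [isQuadricMatrix_conj] at hM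
  rw [det_conj] at hd
  rw [kernelCount_conj, imageCount_conj, kernelCount_sub_single_of_det_ne_zero hω hM hd]

theorem kernelCount_sub_of_isNil {M : Matrix (Fin 3) (Fin 3) F} (hM : IsNil M) {a : Fin 3 → F}
    (ha : a ≠ 0) [Decidable (M *ᵥ a = 0)] [Decidable (∃ b, M = vecMulVec a b)] :
    (kernelCount M a : ℤ) - Nat.card F * imageCount M a =
      Nat.card F ^ 3 - Nat.card F ^ 2
      - (Nat.card F ^ 3 - Nat.card F ^ 2) * (if M *ᵥ a = 0 then 1 else 0)
      + (Nat.card F ^ 4 - Nat.card F ^ 3) * (if ∃ b, M = vecMulVec a b then 1 else 0) := by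
  obtain ⟨A, M', rfl, rfl⟩ := exists_conj_of_ne_zero M ha
  rw [isNil_conj] at hM
  have hz : (A.1 * M' * (A⁻¹).1) *ᵥ (A.1 *ᵥ Pi.single 0 1) = 0 ↔ M' *ᵥ Pi.single 0 1 = 0 := by
    rw [conj_mulVec_mulVec, mulVec_eq_zero_iff_of_unit]
  classical
  rw [kernelCount_conj, imageCount_conj, kernelCount_sub_single_of_det_eq_zero hM,
    if_congr hz (rfl : (1 : ℤ) = 1) (rfl : (0 : ℤ) = 0),
    if_congr (exists_conj_eq_vecMulVec_iff A) (rfl : (1 : ℤ) = 1) (rfl : (0 : ℤ) = 0)]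

end NilpotentCount

/-! ### Double counting pairs of a vector and a nilpotent matrix -/

section DoubleCounting

variable {F : Type*} [Field F]

theorem vecMulVec_eq_zero_iff {a b : Fin 3 → F} : vecMulVec a b = 0 ↔ a = 0 ∨ b = 0 := by
  constructor
  · intro h
    by_contra! hc
    obtain ⟨i, hi⟩ := Function.ne_iff.mp hc.1
    obtain ⟨j, hj⟩ := Function.ne_iff.mp hc.2
    exact mul_ne_zero hi hj (congrFun (congrFun h i) j)
  · rintro (rfl | rfl) <;> simp

/-- The left factor of a nonzero outer product is determined up to a scalar. -/
theorem exists_smul_of_vecMulVec_eq {a b c d : Fin 3 → F} (hb : b ≠ 0)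
    (h : vecMulVec a b = vecMulVec c d) : ∃ r : F, a = r • c := by
  obtain ⟨j, hj⟩ := Function.ne_iff.mp hb
  simp only [Pi.zero_apply] at hj
  refine ⟨d j / b j, ?_⟩
  ext i
  have := congrFun (congrFun h i) j
  simp only [vecMulVec_apply] at this
  simp only [Pi.smul_apply, smul_eq_mul]
  field_simp
  linear_combination this

theorem finrank_ker_dotProduct {b : Fin 3 → F} (hb : b ≠ 0) :
    Module.finrank F (LinearMap.ker (dotProductEquiv F (Fin 3) b)) = 2 := by
  have h := Module.Dual.finrank_ker_add_one_of_ne_zero (f := dotProductEquiv F (Fin 3) b)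
    (by simpa using hb)
  rw [Module.finrank_fin_fun] at h
  omega

theorem card_ne_zero_and {V : Type*} [AddCommGroup V] [Finite V] (P : V → Prop) (h0 : P 0) :
    (Nat.card {v // v ≠ 0 ∧ P v} : ℤ) = Nat.card {v // P v} - 1 := by
  have h : {v | P v} = insert 0 {v | v ≠ 0 ∧ P v} := by
    ext v
    by_cases hv : v = 0
    · simp [hv, h0]
    · simp [hv]
  have h1 : Nat.card {v // P v} = ({v | P v} : Set V).ncard := Nat.card_coe_set_eq _
  have h2 : Nat.card {v // v ≠ 0 ∧ P v} = ({v | v ≠ 0 ∧ P v} : Set V).ncard :=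
    Nat.card_coe_set_eq _
  rw [h1, h2, h, Set.ncard_insert_of_notMem (by simp)]
  push_cast
  ring

theorem card_vecMulVec_ker {a b : Fin 3 → F} (ha : a ≠ 0) (hb : b ≠ 0) :
    Nat.card {v // vecMulVec a b *ᵥ v = 0} = Nat.card F ^ 2 := by
  rw [← finrank_ker_dotProduct hb, ← Module.natCard_eq_pow_finrank]
  refine Nat.card_congr (Equiv.subtypeEquivRight fun v => ?_)
  rw [vecMulVec_mulVec, LinearMap.mem_ker, dotProductEquiv_apply_apply]
  simp [ha]

theorem card_conj_jordan_ker (A : GL (Fin 3) F) :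
    Nat.card {v // (A.1 * jordan * (A⁻¹).1) *ᵥ v = 0} = Nat.card F := by
  have hA : A.1 * (A⁻¹).1 = 1 := by simp
  have hA' : (A⁻¹).1 * A.1 = 1 := by simp
  refine Nat.card_congr
    { toFun := fun v => ((A⁻¹).1 *ᵥ v.1) 0
      invFun := fun c => ⟨A.1 *ᵥ Pi.single 0 c, ?_⟩
      left_inv := ?_
      right_inv := ?_ }
  · rw [conj_mulVec_mulVec, mulVec_eq_zero_iff_of_unit]
    ext i
    fin_cases i <;> simp [jordan]
  · rintro ⟨v, hv⟩
    have hv' : v = A.1 *ᵥ ((A⁻¹).1 *ᵥ v) := by rw [mulVec_mulVec, hA, one_mulVec]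
    refine Subtype.ext ?_
    simp only
    conv_rhs => rw [hv']
    rw [hv', conj_mulVec_mulVec, mulVec_eq_zero_iff_of_unit] at hv
    congr 1
    have e0 := congrFun hv 0
    have e1 := congrFun hv 1
    generalize (A⁻¹).1 *ᵥ v = w at *
    simp [jordan, mulVec, dotProduct, Fin.sum_univ_three] at e0 e1
    ext i
    fin_cases i <;> simp [e0, e1]
  · intro c
    simp only
    rw [mulVec_mulVec, hA', one_mulVec, Pi.single_eq_same]

theorem card_vec {F : Type*} : Nat.card (Fin 3 → F) = Nat.card F ^ 3 := by
  simp [Nat.card_fun]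

theorem isNil_zero : IsNil (0 : Matrix (Fin 3) (Fin 3) F) :=
  ⟨⟨by simp, by simp⟩, by simp⟩

variable [Finite F]

theorem card_left_factor {a b : Fin 3 → F} (ha : a ≠ 0) (hb : b ≠ 0) :
    (Nat.card {v // v ≠ 0 ∧ ∃ d, vecMulVec a b = vecMulVec v d} : ℤ) = Nat.card F - 1 := by
  have h1 : Nat.card {v // v ≠ 0 ∧ ∃ d, vecMulVec a b = vecMulVec v d} =
      Nat.card {c : F // c ≠ 0 ∧ True} := by
    symm
    refine Nat.card_congr (Equiv.ofBijective (fun c => ⟨c.1 • a, smul_ne_zero c.2.1 ha,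
      c.1⁻¹ • b, ?_⟩) ⟨?_, ?_⟩)
    · rw [smul_vecMulVec, vecMulVec_smul, smul_smul, mul_inv_cancel₀ c.2.1, one_smul]
    · intro c d h
      exact Subtype.ext (smul_left_injective F ha (Subtype.ext_iff.mp h))
    · rintro ⟨v, hv, d, hd⟩
      have hd0 : d ≠ 0 := by
        rintro rfl
        rw [vecMulVec_zero, vecMulVec_eq_zero_iff] at hd
        exact hd.elim ha hb
      obtain ⟨r, hr⟩ := exists_smul_of_vecMulVec_eq hd0 hd.symm
      refine ⟨⟨r, ?_, trivial⟩, Subtype.ext hr.symm⟩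
      rintro rfl
      exact hv (by rw [hr, zero_smul])
  rw [h1, card_ne_zero_and _ trivial, Nat.card_congr (Equiv.subtypeUnivEquiv fun _ => trivial)]

/-- For a nonzero nilpotent matrix, the nonzero vectors in the kernel exceed `q` times the nonzero
vectors spanning a line that contains the range by `q - 1`. -/
theorem card_ker_sub_card_left_factor {N : Matrix (Fin 3) (Fin 3) F} (hN : IsNil N) (h0 : N ≠ 0) :
    (Nat.card {v // v ≠ 0 ∧ N *ᵥ v = 0} : ℤ)
      - Nat.card F * Nat.card {v // v ≠ 0 ∧ ∃ b, N = vecMulVec v b} = Nat.card F - 1 := by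
  rw [card_ne_zero_and (fun v => N *ᵥ v = 0) (mulVec_zero N)]
  by_cases h2 : N * N = 0
  · obtain ⟨a, b, rfl⟩ := hN.exists_eq_vecMulVec h2
    rw [Ne, vecMulVec_eq_zero_iff, not_or] at h0
    rw [card_vecMulVec_ker h0.1 h0.2, card_left_factor h0.1 h0.2]
    push_cast
    ring
  -- A trace-zero outer product has square zero, so here the second count is empty, while the kernel
  -- of the Jordan block is a line.
  · have he : IsEmpty {v // v ≠ 0 ∧ ∃ b, N = vecMulVec v b} := by
      refine ⟨fun v => ?_⟩
      obtain ⟨v, -, b, rfl⟩ := v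
      apply h2
      have := hN.1.1
      rw [trace_vecMulVec, dotProduct_comm] at this
      rw [vecMulVec_mul_vecMulVec, this]
      simp
    rw [@Nat.card_of_isEmpty _ he]
    obtain ⟨A, rfl⟩ := exists_conj_jordan hN.mul_sq h2
    rw [card_conj_jordan_ker]
    simp

/-- The zero matrix breaks the uniform value `q - 1`: every vector counts in both sets. It is
therefore a separate term in the double count. -/
theorem card_ker_sub_card_left_factor_zero :
    (Nat.card {v : Fin 3 → F // v ≠ 0 ∧ (0 : Matrix (Fin 3) (Fin 3) F) *ᵥ v = 0} : ℤ)
      - Nat.card F * Nat.card {v : Fin 3 → F // v ≠ 0 ∧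
        ∃ b : Fin 3 → F, (0 : Matrix (Fin 3) (Fin 3) F) = vecMulVec v b} =
      (Nat.card F - 1) * (1 - Nat.card F ^ 3) := by
  rw [card_ne_zero_and _ (by simp), card_ne_zero_and _ ⟨0, by simp⟩,
    Nat.card_congr (Equiv.subtypeUnivEquiv fun v => by simp),
    Nat.card_congr (Equiv.subtypeUnivEquiv fun v => ⟨0, by simp⟩), card_vec]
  push_cast
  ring

theorem card_eq_sum_ite {α : Type*} [Fintype α] (P R : α → Prop) [DecidablePred P]
    [DecidablePred R] :
    (Nat.card {x // P x ∧ R x} : ℤ) = ∑ x with P x, if R x then 1 else 0 := by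
  rw [Nat.card_eq_fintype_card, Fintype.card_subtype, Finset.sum_boole, Finset.filter_filter]

open Classical in
-- Interchange the sums over `a` and `N`. Each nonzero `N` contributes `q - 1` and `N = 0`
-- contributes `(q - 1) (1 - q³)`, so the unknown number of `N` can be read off from local counts.
theorem sum_kernelCount_sub [Fintype F] (M : Matrix (Fin 3) (Fin 3) F) :
    ∑ a : Fin 3 → F with a ≠ 0, ((kernelCount M a : ℤ) - Nat.card F * imageCount M a) =
      (Nat.card F - 1) *
        (Nat.card {N : Matrix (Fin 3) (Fin 3) F // IsNil N ∧ (M * N).trace = 0}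
          - Nat.card F ^ 3) := by
  set K : Finset (Matrix (Fin 3) (Fin 3) F) :=
    Finset.univ.filter fun N => IsNil N ∧ (M * N).trace = 0 with hK
  have h0 : (0 : Matrix (Fin 3) (Fin 3) F) ∈ K := by simp [hK, isNil_zero]
  have hcard : Nat.card {N : Matrix (Fin 3) (Fin 3) F // IsNil N ∧ (M * N).trace = 0} = K.card := by
    rw [Nat.card_eq_fintype_card, Fintype.card_subtype]
  calc _ = ∑ a : Fin 3 → F with a ≠ 0, ∑ N ∈ K, (((if N *ᵥ a = 0 then 1 else 0 : ℤ))
        - Nat.card F * (if ∃ b, N = vecMulVec a b then 1 else 0)) := by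
        refine Finset.sum_congr rfl fun a _ => ?_
        rw [kernelCount, imageCount, card_eq_sum_ite, card_eq_sum_ite, Finset.mul_sum,
          ← Finset.sum_sub_distrib]
    _ = ∑ N ∈ K, ∑ a : Fin 3 → F with a ≠ 0, (((if N *ᵥ a = 0 then 1 else 0 : ℤ))
        - Nat.card F * (if ∃ b, N = vecMulVec a b then 1 else 0)) := Finset.sum_comm
    _ = ∑ N ∈ K, ((Nat.card {v // v ≠ 0 ∧ N *ᵥ v = 0} : ℤ)
      - Nat.card F * Nat.card {v // v ≠ 0 ∧ ∃ b, N = vecMulVec v b}) := by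
        refine Finset.sum_congr rfl fun N _ => ?_
        rw [card_eq_sum_ite, card_eq_sum_ite, Finset.mul_sum, ← Finset.sum_sub_distrib]
    _ = (Nat.card F - 1) * (1 - Nat.card F ^ 3) +
        ∑ N ∈ K.erase 0, ((Nat.card F : ℤ) - 1) := by
        rw [← Finset.add_sum_erase K _ h0, card_ker_sub_card_left_factor_zero]
        congr 1
        refine Finset.sum_congr rfl fun N hN => ?_
        rw [Finset.mem_erase, hK, Finset.mem_filter] at hN
        exact card_ker_sub_card_left_factor hN.2.2.1 hN.1
    _ = _ := by
        rw [Finset.sum_const, Finset.card_erase_of_mem h0, hcard, nsmul_eq_mul,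
          Nat.cast_sub (Finset.card_pos.mpr ⟨0, h0⟩)]
        push_cast
        ring

theorem one_lt_card : (1 : ℤ) < Nat.card F := by
  exact_mod_cast Finite.one_lt_card (α := F)

/-- The number of nilpotent matrices orthogonal to a nonsingular matrix of the quadric. -/
theorem card_nil_orthogonal_of_det_ne_zero {ω : F} (hω : IsCubeRoot ω)
    {M : Matrix (Fin 3) (Fin 3) F} (hM : IsQuadricMatrix M) (hd : M.det ≠ 0) :
    (Nat.card {N : Matrix (Fin 3) (Fin 3) F // IsNil N ∧ (M * N).trace = 0} : ℤ) =
      Nat.card F ^ 5 + Nat.card F ^ 3 - Nat.card F ^ 2 := by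
  classical
  have := Fintype.ofFinite F
  have h := sum_kernelCount_sub M
  rw [Finset.sum_congr rfl fun a ha => kernelCount_sub_of_det_ne_zero hω hM hd
    (Finset.mem_filter.mp ha).2] at h
  have hc := card_ne_zero_and (V := Fin 3 → F) (fun _ => True) trivial
  rw [card_eq_sum_ite, Nat.card_congr (Equiv.subtypeUnivEquiv fun _ => trivial), card_vec] at hc
  rw [← mul_one ((Nat.card F : ℤ) ^ 3 - _), ← Finset.mul_sum] at h
  simp only [if_true] at hc
  rw [hc] at h
  have hq := one_lt_card (F := F)
  have hq' : (Nat.card F : ℤ) - 1 ≠ 0 := by omega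
  apply mul_left_cancel₀ hq'
  push_cast at h
  linear_combination -h

/-- The number of nilpotent matrices orthogonal to a nonzero nilpotent matrix. -/
theorem card_nil_orthogonal_of_isNil {M : Matrix (Fin 3) (Fin 3) F} (hM : IsNil M) (h0 : M ≠ 0) :
    (Nat.card {N : Matrix (Fin 3) (Fin 3) F // IsNil N ∧ (M * N).trace = 0} : ℤ) =
      Nat.card F ^ 5 := by
  classical
  have := Fintype.ofFinite F
  have h := sum_kernelCount_sub M
  rw [Finset.sum_congr rfl fun a ha => kernelCount_sub_of_isNil hM
    (Finset.mem_filter.mp ha).2] at h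
  have hc := card_ne_zero_and (V := Fin 3 → F) (fun _ => True) trivial
  rw [card_eq_sum_ite, Nat.card_congr (Equiv.subtypeUnivEquiv fun _ => trivial), card_vec] at hc
  -- Since `q⁴ - q³ = q (q³ - q²)`, the two corrections summed over `a` amount to `-(q³ - q²)` times
  -- the weighted count of `M` itself, which is `q - 1`.
  have hk := card_ker_sub_card_left_factor hM h0
  rw [card_eq_sum_ite, card_eq_sum_ite] at hk
  rw [Finset.sum_add_distrib, Finset.sum_sub_distrib, ← Finset.mul_sum, ← Finset.mul_sum,
    ← mul_one ((Nat.card F : ℤ) ^ 3 - _), ← Finset.mul_sum] at h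
  simp only [if_true] at hc
  rw [hc] at h
  have hq := one_lt_card (F := F)
  have hq' : (Nat.card F : ℤ) - 1 ≠ 0 := by omega
  apply mul_left_cancel₀ hq'
  push_cast at h
  linear_combination -h - Nat.card F ^ 2 * (Nat.card F - 1) * hk

end DoubleCounting

/-! ### Lines of the hexagon as pencils, and the flag geometry -/

section FlagGeometryOfHexagon

variable {F : Type*} [Field F]

/-- The subspace of the trace-zero matrices whose range lies in the point `p`. -/
def pencilOfPoint (p : ℙ F (Fin 3 → F)) : Submodule F (TraceZero F) where
  carrier := {N | ∀ v, N.1 *ᵥ v ∈ p.submodule}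
  zero_mem' v := by simp
  add_mem' {M N} hM hN v := by
    rw [Submodule.coe_add, add_mulVec]
    exact add_mem (hM v) (hN v)
  smul_mem' c N hN v := by
    rw [Submodule.coe_smul, smul_mulVec]
    exact Submodule.smul_mem _ c (hN v)

/-- The subspace of the trace-zero matrices whose kernel contains the subspace `ℓ`. -/
def pencilOfLine (ℓ : Submodule F (Fin 3 → F)) : Submodule F (TraceZero F) where
  carrier := {N | ∀ v ∈ ℓ, N.1 *ᵥ v = 0}
  zero_mem' v _ := by simp
  add_mem' {M N} hM hN v hv := by
    rw [Submodule.coe_add, add_mulVec, hM v hv, hN v hv, add_zero]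
  smul_mem' c N hN v hv := by
    rw [Submodule.coe_smul, smul_mulVec, hN v hv, smul_zero]

theorem trace_coe (N : TraceZero F) : N.1.trace = 0 := N.2

theorem mem_pencilOfPoint_mk {a : Fin 3 → F} (ha : a ≠ 0) {N : TraceZero F} :
    N ∈ pencilOfPoint (Projectivization.mk F a ha) ↔ ∃ b, N.1 = vecMulVec a b := by
  constructor
  · intro h
    have h' : ∀ j, ∃ c : F, c • a = N.1 *ᵥ Pi.single j 1 := fun j => by
      have := h (Pi.single j 1)
      rwa [Projectivization.submodule_mk, Submodule.mem_span_singleton] at this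
    choose c hc using h'
    refine ⟨c, ?_⟩
    ext i j
    have := congrFun (hc j) i
    rw [mulVec_single_one] at this
    simp only [Pi.smul_apply, smul_eq_mul, col_apply] at this
    rw [vecMulVec_apply, ← this, mul_comm]
  · rintro ⟨b, hb⟩ v
    rw [hb, vecMulVec_mulVec, Projectivization.submodule_mk]
    exact Submodule.mem_span_singleton.mpr ⟨b ⬝ᵥ v, by simp⟩

theorem mem_pencilOfLine_ker {b : Fin 3 → F} (hb : b ≠ 0) {N : TraceZero F} :
    N ∈ pencilOfLine (LinearMap.ker (dotProductEquiv F (Fin 3) b)) ↔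
      ∃ a, N.1 = vecMulVec a b := by
  constructor
  · intro h
    obtain ⟨j, hj⟩ := Function.ne_iff.mp hb
    simp only [Pi.zero_apply] at hj
    refine ⟨(b j)⁻¹ • N.1 *ᵥ Pi.single j 1, ?_⟩
    apply Matrix.ext_of_mulVec_single
    intro k
    have hk := h (Pi.single k 1 - (b k / b j) • Pi.single j 1) (by
      rw [LinearMap.mem_ker, dotProductEquiv_apply_apply]
      simp [hj])
    rw [mulVec_sub, mulVec_smul, sub_eq_zero] at hk
    rw [hk, vecMulVec_mulVec]
    simp [smul_smul, div_eq_mul_inv]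
  · rintro ⟨a, ha⟩ v hv
    rw [LinearMap.mem_ker, dotProductEquiv_apply_apply] at hv
    rw [ha, vecMulVec_mulVec, hv]
    simp

theorem exists_planeLine_eq_ker (ℓ : PlaneLine F) :
    ∃ b : Fin 3 → F, b ≠ 0 ∧ ℓ.1 = LinearMap.ker (dotProductEquiv F (Fin 3) b) := by
  obtain ⟨ℓ, hℓ⟩ := ℓ
  have hlt : ℓ < ⊤ := by
    rw [lt_top_iff_ne_top]
    rintro rfl
    rw [finrank_top, Module.finrank_fin_fun] at hℓ
    omega
  obtain ⟨f, hf, hle⟩ := Submodule.exists_le_ker_of_lt_top ℓ hlt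
  obtain ⟨b, rfl⟩ := (dotProductEquiv F (Fin 3)).surjective f
  have hb : b ≠ 0 := by
    rintro rfl
    simp at hf
  exact ⟨b, hb, Submodule.eq_of_le_of_finrank_eq hle (by rw [hℓ, finrank_ker_dotProduct hb])⟩

/-- The line of `PG(2, q)` with equation `b ⬝ᵥ v = 0`. -/
def planeLineOf {b : Fin 3 → F} (hb : b ≠ 0) : PlaneLine F :=
  ⟨LinearMap.ker (dotProductEquiv F (Fin 3) b), finrank_ker_dotProduct hb⟩

theorem exists_planeLineOf (ℓ : PlaneLine F) :
    ∃ (b : Fin 3 → F) (hb : b ≠ 0), ℓ = planeLineOf hb := by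
  obtain ⟨b, hb, h⟩ := exists_planeLine_eq_ker ℓ
  exact ⟨b, hb, Subtype.ext h⟩

theorem exists_mk (p : ℙ F (Fin 3 → F)) :
    ∃ (a : Fin 3 → F) (ha : a ≠ 0), p = Projectivization.mk F a ha :=
  ⟨p.rep, p.rep_nonzero, p.mk_rep.symm⟩

theorem mk_le_planeLineOf {a b : Fin 3 → F} (ha : a ≠ 0) (hb : b ≠ 0) :
    (Projectivization.mk F a ha).submodule ≤ (planeLineOf hb).1 ↔ a ⬝ᵥ b = 0 := by
  rw [Projectivization.submodule_mk, Submodule.span_singleton_le_iff_mem, planeLineOf,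
    LinearMap.mem_ker, dotProductEquiv_apply_apply, dotProduct_comm]

/-- The trace-zero rank-one matrices with a fixed left factor. -/
def leftOuter (a : Fin 3 → F) :
    LinearMap.ker (dotProductEquiv F (Fin 3) a) →ₗ[F] TraceZero F where
  toFun b := ⟨vecMulVec a b.1, by
    have := b.2
    rw [LinearMap.mem_ker, dotProductEquiv_apply_apply] at this
    rw [LinearMap.mem_ker, traceLinearMap_apply, trace_vecMulVec, this]⟩
  map_add' b c := Subtype.ext (vecMulVec_add _ _ _)
  map_smul' r b := Subtype.ext (vecMulVec_smul _ _ _)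

/-- The trace-zero rank-one matrices with a fixed right factor. -/
def rightOuter (b : Fin 3 → F) :
    LinearMap.ker (dotProductEquiv F (Fin 3) b) →ₗ[F] TraceZero F where
  toFun a := ⟨vecMulVec a.1 b, by
    have := a.2
    rw [LinearMap.mem_ker, dotProductEquiv_apply_apply] at this
    rw [LinearMap.mem_ker, traceLinearMap_apply, trace_vecMulVec, dotProduct_comm, this]⟩
  map_add' a c := Subtype.ext (add_vecMulVec _ _ _)
  map_smul' r a := Subtype.ext (smul_vecMulVec _ _ _)

theorem finrank_pencilOfPoint (p : ℙ F (Fin 3 → F)) :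
    Module.finrank F (pencilOfPoint p) = 2 := by
  obtain ⟨a, ha, rfl⟩ := exists_mk p
  have h : pencilOfPoint (Projectivization.mk F a ha) = LinearMap.range (leftOuter a) := by
    ext N
    rw [mem_pencilOfPoint_mk, LinearMap.mem_range]
    constructor
    · rintro ⟨b, hb⟩
      have ht := trace_coe N
      rw [hb, trace_vecMulVec] at ht
      exact ⟨⟨b, by rw [LinearMap.mem_ker, dotProductEquiv_apply_apply, ht]⟩, Subtype.ext hb.symm⟩
    · rintro ⟨b, rfl⟩
      exact ⟨b.1, rfl⟩
  rw [h, LinearMap.finrank_range_of_inj, finrank_ker_dotProduct ha]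
  rw [← LinearMap.ker_eq_bot, LinearMap.ker_eq_bot']
  intro b hb
  exact Subtype.ext ((vecMulVec_eq_zero_iff.mp (Subtype.ext_iff.mp hb)).resolve_left ha)

theorem finrank_pencilOfLine (ℓ : PlaneLine F) :
    Module.finrank F (pencilOfLine ℓ.1) = 2 := by
  obtain ⟨b, hb, rfl⟩ := exists_planeLineOf ℓ
  have h : pencilOfLine (planeLineOf hb).1 = LinearMap.range (rightOuter b) := by
    ext N
    rw [planeLineOf, mem_pencilOfLine_ker hb, LinearMap.mem_range]
    constructor
    · rintro ⟨a, ha⟩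
      have ht := trace_coe N
      rw [ha, trace_vecMulVec, dotProduct_comm] at ht
      exact ⟨⟨a, by rw [LinearMap.mem_ker, dotProductEquiv_apply_apply, ht]⟩, Subtype.ext ha.symm⟩
    · rintro ⟨a, rfl⟩
      exact ⟨a.1, rfl⟩
  rw [h, LinearMap.finrank_range_of_inj, finrank_ker_dotProduct hb]
  rw [← LinearMap.ker_eq_bot, LinearMap.ker_eq_bot']
  intro a ha
  exact Subtype.ext ((vecMulVec_eq_zero_iff.mp (Subtype.ext_iff.mp ha)).resolve_right hb)

theorem mk_mem_hexPoints {N : TraceZero F} (hN : N ≠ 0) :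
    Projectivization.mk F N hN ∈ hexPoints F ↔ ∃ a b, N.1 = vecMulVec a b := by
  have hN' : N.1 ≠ 0 := fun h => hN (Subtype.ext h)
  rw [hexPoints, Set.mem_ofPred_eq, Projectivization.map_mk, segre, Set.mem_ofPred_eq]
  simp only [Projectivization.submodule_mk]
  constructor
  · rintro ⟨a, b, -, -, h⟩
    have : N.1 ∈ Submodule.span F {vecMulVec a b} := h ▸ Submodule.mem_span_singleton_self _
    obtain ⟨c, hc⟩ := Submodule.mem_span_singleton.mp this
    exact ⟨c • a, b, by rw [smul_vecMulVec, hc]⟩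
  · rintro ⟨a, b, h⟩
    rw [h, Ne, vecMulVec_eq_zero_iff, not_or] at hN'
    exact ⟨a, b, hN'.1, hN'.2, by rw [← h]; rfl⟩

theorem mk_le {V : Type*} [AddCommGroup V] [Module F V] {v : V} (hv : v ≠ 0)
    {U : Submodule F V} : (Projectivization.mk F v hv).submodule ≤ U ↔ v ∈ U := by
  rw [Projectivization.submodule_mk, Submodule.span_singleton_le_iff_mem]

theorem pencilOfPoint_mem_hexLines (p : ℙ F (Fin 3 → F)) : pencilOfPoint p ∈ hexLines F := by
  refine ⟨finrank_pencilOfPoint p, fun x hx => ?_⟩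
  obtain ⟨a, ha, rfl⟩ := exists_mk p
  induction x using Projectivization.ind with
  | h N hN =>
    rw [mk_le, mem_pencilOfPoint_mk] at hx
    exact (mk_mem_hexPoints hN).mpr ⟨a, hx⟩

theorem pencilOfLine_mem_hexLines (ℓ : PlaneLine F) : pencilOfLine ℓ.1 ∈ hexLines F := by
  refine ⟨finrank_pencilOfLine ℓ, fun x hx => ?_⟩
  obtain ⟨b, hb, rfl⟩ := exists_planeLineOf ℓ
  induction x using Projectivization.ind with
  | h N hN =>
    rw [mk_le, planeLineOf, mem_pencilOfLine_ker hb] at hx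
    obtain ⟨a, ha⟩ := hx
    exact (mk_mem_hexPoints hN).mpr ⟨a, b, ha⟩

theorem exists_smul_of_minors_eq_zero {a c : Fin 3 → F} (ha : a ≠ 0)
    (h : ∀ i j, a i * c j = a j * c i) : ∃ r : F, c = r • a := by
  obtain ⟨i, hi⟩ := Function.ne_iff.mp ha
  simp only [Pi.zero_apply] at hi
  refine ⟨c i / a i, ?_⟩
  ext j
  simp only [Pi.smul_apply, smul_eq_mul]
  field_simp
  linear_combination h i j

/-- If the sum of two nonzero outer products is an outer product, then the left factors or the
right factors are proportional. -/
theorem proportional_of_vecMulVec_add {a b c d e f : Fin 3 → F} (ha : a ≠ 0) (hb : b ≠ 0)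
    (h : vecMulVec a b + vecMulVec c d = vecMulVec e f) :
    (∃ r : F, c = r • a) ∨ ∃ r : F, d = r • b := by
  by_contra! hc
  have h1 : ∃ i j, a i * c j ≠ a j * c i := by
    by_contra! h'
    obtain ⟨r, hr⟩ := exists_smul_of_minors_eq_zero ha h'
    exact hc.1 r hr
  have h2 : ∃ k l, b k * d l ≠ b l * d k := by
    by_contra! h'
    obtain ⟨r, hr⟩ := exists_smul_of_minors_eq_zero hb h'
    exact hc.2 r hr
  obtain ⟨i, j, hij⟩ := h1
  obtain ⟨k, l, hkl⟩ := h2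
  have H : ∀ i k, a i * b k + c i * d k = e i * f k := fun i k => by
    have := congrFun (congrFun h i) k
    simpa [vecMulVec_apply] using this
  -- Cauchy–Binet: the `2 × 2` minor of `a bᵀ + c dᵀ` in rows `i, j` and columns `k, l` is this
  -- product of minors, whereas an outer product has zero minors.
  apply mul_ne_zero (sub_ne_zero.mpr hij) (sub_ne_zero.mpr hkl)
  linear_combination (a j * b l + c j * d l) * H i k + (e i * f k) * H j l
    - (a j * b k + c j * d k) * H i l - (e i * f l) * H j k

/-- Fix `a bᵀ` in `U`. If some `c dᵀ` in `U` has left factor not proportional to `a`, then `d` is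
proportional to `b`, and these two matrices span `U`, so the right factor is constant on it.
Otherwise the left factor is constant. -/
theorem exists_pencil_eq_of_mem_hexLines {U : Submodule F (TraceZero F)} (hU : U ∈ hexLines F) :
    (∃ p, U = pencilOfPoint p) ∨ ∃ ℓ : PlaneLine F, U = pencilOfLine ℓ.1 := by
  obtain ⟨hdim, hpts⟩ := hU
  have hout : ∀ N ∈ U, N ≠ 0 → ∃ a b, N.1 = vecMulVec a b := fun N hN h0 =>
    (mk_mem_hexPoints h0).mp (hpts _ ((mk_le h0).mpr hN))
  have hne : U ≠ ⊥ := by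
    rintro rfl
    rw [finrank_bot] at hdim
    omega
  obtain ⟨N₁, hN₁, h₁⟩ := Submodule.exists_mem_ne_zero_of_ne_bot hne
  obtain ⟨a, b, hab⟩ := hout N₁ hN₁ h₁
  have h₁' : N₁.1 ≠ 0 := fun h => h₁ (Subtype.ext h)
  rw [hab, Ne, vecMulVec_eq_zero_iff, not_or] at h₁'
  obtain ⟨ha, hb⟩ := h₁'
  by_cases hall : U ≤ pencilOfPoint (Projectivization.mk F a ha)
  · exact Or.inl ⟨_, Submodule.eq_of_le_of_finrank_eq hall (by rw [hdim, finrank_pencilOfPoint])⟩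
  · right
    obtain ⟨N₂, hN₂, h₂⟩ := SetLike.not_le_iff_exists.mp hall
    rw [mem_pencilOfPoint_mk ha] at h₂
    have h20 : N₂ ≠ 0 := by
      rintro rfl
      exact h₂ ⟨0, by simp⟩
    obtain ⟨c, d, hcd⟩ := hout N₂ hN₂ h20
    have hcr : ¬ ∃ r : F, c = r • a := by
      rintro ⟨r, rfl⟩
      exact h₂ ⟨r • d, by rw [hcd, smul_vecMulVec, vecMulVec_smul]⟩
    have hdr : ∃ r : F, d = r • b := by
      by_cases hs : N₁ + N₂ = 0
      · exfalso
        apply h₂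
        refine ⟨-b, ?_⟩
        rw [eq_neg_of_add_eq_zero_right hs, Submodule.coe_neg, hab, vecMulVec_neg]
      · obtain ⟨e, f, hef⟩ := hout _ (add_mem hN₁ hN₂) hs
        rw [Submodule.coe_add, hab, hcd] at hef
        exact (proportional_of_vecMulVec_add ha hb hef).resolve_left hcr
    obtain ⟨r, rfl⟩ := hdr
    have hli : LinearIndependent F ![N₁, N₂] := by
      rw [LinearIndependent.pair_iff' h₁]
      intro s hs
      exact h₂ ⟨s • b, by rw [← hs, Submodule.coe_smul, hab, vecMulVec_smul]⟩
    have hspan : Submodule.span F (Set.range ![N₁, N₂]) = U := by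
      refine Submodule.eq_of_le_of_finrank_eq ?_ ?_
      · rw [Submodule.span_le]
        rintro _ ⟨i, rfl⟩
        fin_cases i
        · exact hN₁
        · exact hN₂
      · rw [finrank_span_eq_card hli, hdim]
        simp
    refine ⟨planeLineOf hb, Submodule.eq_of_le_of_finrank_eq ?_
      (by rw [hdim, finrank_pencilOfLine])⟩
    rw [← hspan, Submodule.span_le]
    rintro _ ⟨i, rfl⟩
    rw [planeLineOf, SetLike.mem_coe, mem_pencilOfLine_ker hb]
    fin_cases i
    · exact ⟨a, hab⟩
    · exact ⟨r • c, by simp [hcd, smul_vecMulVec, vecMulVec_smul]⟩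

theorem mem_pencilOfPoint_unique {N : TraceZero F} (hN : N ≠ 0) {p p' : ℙ F (Fin 3 → F)}
    (h : N ∈ pencilOfPoint p) (h' : N ∈ pencilOfPoint p') : p = p' := by
  obtain ⟨a, ha, rfl⟩ := exists_mk p
  obtain ⟨a', ha', rfl⟩ := exists_mk p'
  obtain ⟨b, hb⟩ := (mem_pencilOfPoint_mk ha).mp h
  obtain ⟨b', hb'⟩ := (mem_pencilOfPoint_mk ha').mp h'
  have hb0 : b ≠ 0 := by
    rintro rfl
    exact hN (Subtype.ext (by simpa using hb))
  obtain ⟨r, hr⟩ := exists_smul_of_vecMulVec_eq hb0 (hb.symm.trans hb')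
  exact (Projectivization.mk_eq_mk_iff' F a a' ha ha').mpr ⟨r, hr.symm⟩

theorem exists_smul_of_vecMulVec_eq_right {a b c d : Fin 3 → F} (ha : a ≠ 0)
    (h : vecMulVec a b = vecMulVec c d) : ∃ r : F, b = r • d := by
  refine exists_smul_of_vecMulVec_eq (b := a) (d := c) ha ?_
  rw [← transpose_vecMulVec, ← transpose_vecMulVec c d, h]

theorem mem_pencilOfLine_unique {N : TraceZero F} (hN : N ≠ 0) {ℓ ℓ' : PlaneLine F}
    (h : N ∈ pencilOfLine ℓ.1) (h' : N ∈ pencilOfLine ℓ'.1) : ℓ = ℓ' := by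
  obtain ⟨b, hb, rfl⟩ := exists_planeLineOf ℓ
  obtain ⟨b', hb', rfl⟩ := exists_planeLineOf ℓ'
  obtain ⟨a, ha⟩ := (mem_pencilOfLine_ker hb).mp h
  obtain ⟨a', ha'⟩ := (mem_pencilOfLine_ker hb').mp h'
  have ha0 : a ≠ 0 := by
    rintro rfl
    exact hN (Subtype.ext (by simpa using ha))
  obtain ⟨r, rfl⟩ := exists_smul_of_vecMulVec_eq_right ha0 (ha.symm.trans ha')
  have hr : r ≠ 0 := by
    rintro rfl
    simp at hb
  refine Subtype.ext ?_
  ext v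
  simp [planeLineOf, hr]

theorem mem_span_of_mem_pencils {p : ℙ F (Fin 3 → F)} {ℓ : PlaneLine F} {N N' : TraceZero F}
    (h : N ∈ pencilOfPoint p ⊓ pencilOfLine ℓ.1) (h' : N' ∈ pencilOfPoint p ⊓ pencilOfLine ℓ.1)
    (hN : N ≠ 0) : N' ∈ Submodule.span F {N} := by
  obtain ⟨a, ha, rfl⟩ := exists_mk p
  obtain ⟨b, hb, rfl⟩ := exists_planeLineOf ℓ
  have key : ∀ M ∈ pencilOfPoint (Projectivization.mk F a ha) ⊓ pencilOfLine (planeLineOf hb).1,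
      ∃ r : F, M.1 = r • vecMulVec a b := by
    intro M hM
    obtain ⟨b', hb'⟩ := (mem_pencilOfPoint_mk ha).mp hM.1
    obtain ⟨a', ha'⟩ := (mem_pencilOfLine_ker hb).mp hM.2
    obtain ⟨r, rfl⟩ := exists_smul_of_vecMulVec_eq_right ha (hb'.symm.trans ha')
    exact ⟨r, by rw [hb', vecMulVec_smul]⟩
  obtain ⟨r, hr⟩ := key N h
  obtain ⟨r', hr'⟩ := key N' h'
  have hr0 : r ≠ 0 := by
    rintro rfl
    exact hN (Subtype.ext (by simpa using hr))
  refine Submodule.mem_span_singleton.mpr ⟨r' / r, Subtype.ext ?_⟩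
  rw [Submodule.coe_smul, hr, hr', smul_smul, div_mul_cancel₀ _ hr0]

/-- The flag attached to a point of the hexagon. -/
theorem exists_flag_of_mem_hexPoints {x : ℙ F (TraceZero F)} (hx : x ∈ hexPoints F) :
    ∃ f : Flag F, x.submodule ≤ pencilOfPoint f.1.1 ∧ x.submodule ≤ pencilOfLine f.1.2.1 := by
  induction x using Projectivization.ind with
  | h N hN =>
    obtain ⟨a, b, hab⟩ := (mk_mem_hexPoints hN).mp hx
    have h0 : N.1 ≠ 0 := fun h => hN (Subtype.ext h)
    have ht := trace_coe N
    rw [hab, trace_vecMulVec] at ht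
    rw [hab, Ne, vecMulVec_eq_zero_iff, not_or] at h0
    refine ⟨⟨(Projectivization.mk F a h0.1, planeLineOf h0.2), ?_⟩, ?_, ?_⟩
    · exact (mk_le_planeLineOf h0.1 h0.2).mpr ht
    · exact (mk_le hN).mpr ((mem_pencilOfPoint_mk h0.1).mpr ⟨b, hab⟩)
    · exact (mk_le hN).mpr ((mem_pencilOfLine_ker h0.2).mpr ⟨a, hab⟩)

theorem exists_mem_hexPoints_of_flag (f : Flag F) :
    ∃ x ∈ hexPoints F, x.submodule ≤ pencilOfPoint f.1.1 ∧
      x.submodule ≤ pencilOfLine f.1.2.1 := by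
  obtain ⟨⟨p, ℓ⟩, hf⟩ := f
  obtain ⟨a, ha, rfl⟩ := exists_mk p
  obtain ⟨b, hb, rfl⟩ := exists_planeLineOf ℓ
  have hab := (mk_le_planeLineOf ha hb).mp hf
  let N : TraceZero F := ⟨vecMulVec a b, by
    rw [LinearMap.mem_ker, traceLinearMap_apply, trace_vecMulVec, hab]⟩
  have hN : N ≠ 0 := fun h => (vecMulVec_eq_zero_iff.mp (Subtype.ext_iff.mp h)).elim ha hb
  exact ⟨Projectivization.mk F N hN, (mk_mem_hexPoints hN).mpr ⟨a, b, rfl⟩,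
    (mk_le hN).mpr ((mem_pencilOfPoint_mk ha).mpr ⟨b, rfl⟩),
    (mk_le hN).mpr ((mem_pencilOfLine_ker hb).mpr ⟨a, rfl⟩)⟩

theorem le_pencilOfPoint_unique {x : ℙ F (TraceZero F)} {p p' : ℙ F (Fin 3 → F)}
    (h : x.submodule ≤ pencilOfPoint p) (h' : x.submodule ≤ pencilOfPoint p') : p = p' := by
  induction x using Projectivization.ind with
  | h N hN => exact mem_pencilOfPoint_unique hN ((mk_le hN).mp h) ((mk_le hN).mp h')

theorem le_pencilOfLine_unique {x : ℙ F (TraceZero F)} {ℓ ℓ' : PlaneLine F}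
    (h : x.submodule ≤ pencilOfLine ℓ.1) (h' : x.submodule ≤ pencilOfLine ℓ'.1) : ℓ = ℓ' := by
  induction x using Projectivization.ind with
  | h N hN => exact mem_pencilOfLine_unique hN ((mk_le hN).mp h) ((mk_le hN).mp h')

/-- Fixing both factors up to scalars fixes the outer product up to a scalar. This recovers a
hexagon point from its flag, and it makes the span of its two lines a plane. -/
theorem pencilOfPoint_inf_pencilOfLine {x : ℙ F (TraceZero F)} {p : ℙ F (Fin 3 → F)}
    {ℓ : PlaneLine F} (h : x.submodule ≤ pencilOfPoint p)
    (h' : x.submodule ≤ pencilOfLine ℓ.1) :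
    pencilOfPoint p ⊓ pencilOfLine ℓ.1 = x.submodule := by
  refine le_antisymm ?_ (le_inf h h')
  induction x using Projectivization.ind with
  | h N hN =>
    intro N' hN'
    rw [Projectivization.submodule_mk]
    exact mem_span_of_mem_pencils ⟨(mk_le hN).mp h, (mk_le hN).mp h'⟩ hN' hN

theorem exists_point_le {V : Type*} [AddCommGroup V] [Module F V] {U : Submodule F V}
    (hU : U ≠ ⊥) : ∃ x : ℙ F V, x.submodule ≤ U := by
  obtain ⟨v, hv, h0⟩ := Submodule.exists_mem_ne_zero_of_ne_bot hU
  exact ⟨Projectivization.mk F v h0, (mk_le h0).mpr hv⟩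

theorem exists_point_le_pencilOfPoint (p : ℙ F (Fin 3 → F)) :
    ∃ x : ℙ F (TraceZero F), x.submodule ≤ pencilOfPoint p := by
  refine exists_point_le fun h => ?_
  have := finrank_pencilOfPoint p
  rw [h, finrank_bot] at this
  omega

theorem exists_point_le_pencilOfLine (ℓ : PlaneLine F) :
    ∃ x : ℙ F (TraceZero F), x.submodule ≤ pencilOfLine ℓ.1 := by
  refine exists_point_le fun h => ?_
  have := finrank_pencilOfLine ℓ
  rw [h, finrank_bot] at this
  omega

theorem pencilOfPoint_ne_pencilOfLine (p : ℙ F (Fin 3 → F)) (ℓ : PlaneLine F) :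
    pencilOfPoint p ≠ pencilOfLine ℓ.1 := by
  intro h
  obtain ⟨x, hx⟩ := exists_point_le_pencilOfPoint p
  have h1 := pencilOfPoint_inf_pencilOfLine hx (h ▸ hx)
  rw [← h, inf_idem] at h1
  have h2 := finrank_pencilOfPoint p
  rw [h1, Projectivization.finrank_submodule] at h2
  omega

theorem pencilOfPoint_injective : Function.Injective (pencilOfPoint (F := F)) := by
  intro p p' h
  obtain ⟨x, hx⟩ := exists_point_le_pencilOfPoint p
  exact le_pencilOfPoint_unique hx (h ▸ hx)

theorem pencilOfLine_injective {ℓ ℓ' : PlaneLine F} (h : pencilOfLine ℓ.1 = pencilOfLine ℓ'.1) :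
    ℓ = ℓ' := by
  obtain ⟨x, hx⟩ := exists_point_le_pencilOfLine ℓ
  exact le_pencilOfLine_unique hx (h ▸ hx)

/-- The points of the hexagon correspond to the flags, and its lines to the points and lines of
the plane. -/
theorem exists_equiv_flagGeometry :
    ∃ (e : hexPoints F ≃ Flag F) (f : hexLines F ≃ ℙ F (Fin 3 → F) ⊕ PlaneLine F),
      ∀ (x : hexPoints F) (ℓ : hexLines F),
        x.1.submodule ≤ ℓ.1 ↔ flagIncident (e x) (f ℓ) := by
  have hflag := fun x : hexPoints F => exists_flag_of_mem_hexPoints x.2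
  choose φ hφ₁ hφ₂ using hflag
  have hφ : Function.Bijective φ := by
    constructor
    · intro x y h
      refine Subtype.ext (Projectivization.submodule_injective ?_)
      rw [← pencilOfPoint_inf_pencilOfLine (hφ₁ x) (hφ₂ x),
        ← pencilOfPoint_inf_pencilOfLine (hφ₁ y) (hφ₂ y), h]
    · intro f
      obtain ⟨x, hx, h1, h2⟩ := exists_mem_hexPoints_of_flag f
      refine ⟨⟨x, hx⟩, Subtype.ext (Prod.ext ?_ ?_)⟩
      · exact le_pencilOfPoint_unique (hφ₁ ⟨x, hx⟩) h1
      · exact le_pencilOfLine_unique (hφ₂ ⟨x, hx⟩) h2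
  let ψ : ℙ F (Fin 3 → F) ⊕ PlaneLine F → hexLines F := Sum.elim
    (fun p => ⟨pencilOfPoint p, pencilOfPoint_mem_hexLines p⟩)
    (fun ℓ => ⟨pencilOfLine ℓ.1, pencilOfLine_mem_hexLines ℓ⟩)
  have hψ : Function.Bijective ψ := by
    constructor
    · rintro (p | ℓ) (p' | ℓ') h
      · exact congrArg Sum.inl (pencilOfPoint_injective (Subtype.ext_iff.mp h))
      · exact (pencilOfPoint_ne_pencilOfLine p ℓ' (Subtype.ext_iff.mp h)).elim
      · exact (pencilOfPoint_ne_pencilOfLine p' ℓ (Subtype.ext_iff.mp h).symm).elim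
      · exact congrArg Sum.inr (pencilOfLine_injective (Subtype.ext_iff.mp h))
    · rintro ⟨U, hU⟩
      rcases exists_pencil_eq_of_mem_hexLines hU with ⟨p, rfl⟩ | ⟨ℓ, rfl⟩
      · exact ⟨Sum.inl p, rfl⟩
      · exact ⟨Sum.inr ℓ, rfl⟩
  refine ⟨Equiv.ofBijective φ hφ, (Equiv.ofBijective ψ hψ).symm, fun x U => ?_⟩
  obtain ⟨s, rfl⟩ := (Equiv.ofBijective ψ hψ).surjective U
  rw [Equiv.symm_apply_apply, Equiv.ofBijective_apply, Equiv.ofBijective_apply]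
  rcases s with p | ℓ
  · change x.1.submodule ≤ pencilOfPoint p ↔ (φ x).1.1 = p
    constructor
    · exact le_pencilOfPoint_unique (hφ₁ x)
    · rintro rfl
      exact hφ₁ x
  · change x.1.submodule ≤ pencilOfLine ℓ.1 ↔ (φ x).1.2 = ℓ
    constructor
    · exact le_pencilOfLine_unique (hφ₂ x)
    · rintro rfl
      exact hφ₂ x

theorem hexLinesThrough_eq {x : ℙ F (TraceZero F)} {p : ℙ F (Fin 3 → F)}
    {ℓ : PlaneLine F} (h : x.submodule ≤ pencilOfPoint p)
    (h' : x.submodule ≤ pencilOfLine ℓ.1) :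
    hexLinesThrough x = {pencilOfPoint p, pencilOfLine ℓ.1} := by
  ext U
  rw [hexLinesThrough, Set.mem_ofPred_eq, Set.mem_insert_iff, Set.mem_singleton_iff]
  constructor
  · rintro ⟨hU, hx⟩
    rcases exists_pencil_eq_of_mem_hexLines hU with ⟨p', rfl⟩ | ⟨ℓ', rfl⟩
    · exact Or.inl (by rw [le_pencilOfPoint_unique h hx])
    · exact Or.inr (by rw [le_pencilOfLine_unique h' hx])
  · rintro (rfl | rfl)
    · exact ⟨pencilOfPoint_mem_hexLines p, h⟩
    · exact ⟨pencilOfLine_mem_hexLines ℓ, h'⟩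

theorem hexPlane_eq {x : ℙ F (TraceZero F)} {p : ℙ F (Fin 3 → F)}
    {ℓ : PlaneLine F} (h : x.submodule ≤ pencilOfPoint p)
    (h' : x.submodule ≤ pencilOfLine ℓ.1) :
    hexPlane x = pencilOfPoint p ⊔ pencilOfLine ℓ.1 := by
  rw [hexPlane, hexLinesThrough_eq h h', sSup_pair]

theorem ncard_hexLinesThrough {x : ℙ F (TraceZero F)} (hx : x ∈ hexPoints F) :
    (hexLinesThrough x).ncard = 2 := by
  obtain ⟨f, h, h'⟩ := exists_flag_of_mem_hexPoints hx
  rw [hexLinesThrough_eq h h', Set.ncard_pair (pencilOfPoint_ne_pencilOfLine _ _)]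

theorem finrank_hexPlane {x : ℙ F (TraceZero F)} (hx : x ∈ hexPoints F) :
    Module.finrank F (hexPlane x) = 3 := by
  obtain ⟨f, h, h'⟩ := exists_flag_of_mem_hexPoints hx
  have hs := Submodule.finrank_sup_add_finrank_inf_eq (pencilOfPoint f.1.1) (pencilOfLine f.1.2.1)
  rw [pencilOfPoint_inf_pencilOfLine h h', Projectivization.finrank_submodule,
    finrank_pencilOfPoint, finrank_pencilOfLine] at hs
  rw [hexPlane_eq h h']
  omega

/-! ### The planes `π_x` and the nilpotent matrices -/

theorem isNil_vecMulVec_add {a b c d : Fin 3 → F} (hab : a ⬝ᵥ b = 0) (hcd : c ⬝ᵥ d = 0)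
    (had : a ⬝ᵥ d = 0) : IsNil (vecMulVec a b + vecMulVec c d) := by
  refine ⟨⟨by rw [trace_add, trace_vecMulVec, trace_vecMulVec, hab, hcd, add_zero], ?_⟩, ?_⟩
  -- The form takes the value `(c ⬝ b) (a ⬝ d) - (a ⬝ b) (c ⬝ d)` here. The determinant below
  -- vanishes identically, the rank being at most `2`.
  · simp only [dotProduct, Fin.sum_univ_three] at hab hcd had
    rw [form8_apply]
    simp only [vecMulVec_apply, Matrix.add_apply]
    linear_combination (c 0 * b 0 + c 1 * b 1 + c 2 * b 2) * had
      - (c 0 * d 0 + c 1 * d 1 + c 2 * d 2) * hab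
  · rw [det_fin_three]
    simp only [vecMulVec_apply, Matrix.add_apply]
    ring

theorem isNil_of_mem_hexPlane {x : ℙ F (TraceZero F)} (hx : x ∈ hexPoints F) {N : TraceZero F}
    (hN : N ∈ hexPlane x) : IsNil N.1 := by
  obtain ⟨⟨⟨p, ℓ⟩, hf⟩, h, h'⟩ := exists_flag_of_mem_hexPoints hx
  rw [hexPlane_eq h h'] at hN
  obtain ⟨a, ha, rfl⟩ := exists_mk p
  obtain ⟨b, hb, rfl⟩ := exists_planeLineOf ℓ
  have hab := (mk_le_planeLineOf ha hb).mp hf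
  obtain ⟨N₁, h₁, N₂, h₂, rfl⟩ := Submodule.mem_sup.mp hN
  obtain ⟨b', hb'⟩ := (mem_pencilOfPoint_mk ha).mp h₁
  obtain ⟨a', ha'⟩ := (mem_pencilOfLine_ker hb).mp h₂
  have t₁ := trace_coe N₁
  have t₂ := trace_coe N₂
  rw [hb', trace_vecMulVec] at t₁
  rw [ha', trace_vecMulVec] at t₂
  rw [Submodule.coe_add, hb', ha']
  exact isNil_vecMulVec_add t₁ t₂ hab

theorem exists_mem_hexPlane {a b c d : Fin 3 → F} (ha : a ≠ 0) (hd : d ≠ 0) (hab : a ⬝ᵥ b = 0)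
    (hcd : c ⬝ᵥ d = 0) (had : a ⬝ᵥ d = 0) {N : TraceZero F}
    (hN : N.1 = vecMulVec a b + vecMulVec c d) : ∃ x ∈ hexPoints F, N ∈ hexPlane x := by
  obtain ⟨x, hx, h1, h2⟩ := exists_mem_hexPoints_of_flag
    ⟨(Projectivization.mk F a ha, planeLineOf hd), (mk_le_planeLineOf ha hd).mpr had⟩
  refine ⟨x, hx, ?_⟩
  rw [hexPlane_eq h1 h2]
  refine Submodule.mem_sup.mpr ⟨⟨vecMulVec a b, ?_⟩, (mem_pencilOfPoint_mk ha).mpr ⟨b, rfl⟩,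
    ⟨vecMulVec c d, ?_⟩, (mem_pencilOfLine_ker hd).mpr ⟨c, rfl⟩, Subtype.ext hN.symm⟩
  · rw [LinearMap.mem_ker, traceLinearMap_apply, trace_vecMulVec, hab]
  · rw [LinearMap.mem_ker, traceLinearMap_apply, trace_vecMulVec, hcd]

theorem jordan_eq : (jordan : Matrix (Fin 3) (Fin 3) F) =
    vecMulVec (Pi.single 0 1) (Pi.single 1 1) + vecMulVec (Pi.single 1 1) (Pi.single 2 1) := by
  ext i j
  fin_cases i <;> fin_cases j <;> simp [jordan, vecMulVec_apply]

theorem mulVec_dotProduct_vecMul_inv (A : GL (Fin 3) F) (u v : Fin 3 → F) :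
    (A.1 *ᵥ u) ⬝ᵥ (v ᵥ* (A⁻¹).1) = u ⬝ᵥ v := by
  rw [← dotProduct_comm, ← dotProduct_mulVec, mulVec_mulVec, dotProduct_comm u]
  simp

/-- A square-zero `N = a bᵀ` lies in the plane of its own flag. Otherwise `N` is conjugate to `e₁
e₂ᵀ + e₂ e₃ᵀ`, and the flag is the transport of `(e₁, e₃)`: its point spans the image of `N²` and
its line is the kernel of `N²`. -/
theorem exists_mem_hexPlane_of_isNil {N : TraceZero F} (h : IsNil N.1) (h0 : N ≠ 0) :
    ∃ x ∈ hexPoints F, N ∈ hexPlane x := by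
  by_cases h2 : N.1 * N.1 = 0
  · obtain ⟨a, b, hab⟩ := h.exists_eq_vecMulVec h2
    have hN : N.1 ≠ 0 := fun h => h0 (Subtype.ext h)
    have ht := trace_coe N
    rw [hab, Ne, vecMulVec_eq_zero_iff, not_or] at hN
    rw [hab, trace_vecMulVec] at ht
    exact exists_mem_hexPlane (c := 0) hN.1 hN.2 ht (by simp) ht (by simpa using hab)
  · obtain ⟨A, hA⟩ := exists_conj_jordan h.mul_sq h2
    rw [jordan_eq, mul_add, add_mul, conj_vecMulVec, conj_vecMulVec] at hA
    refine exists_mem_hexPlane ?_ ?_ ?_ ?_ ?_ hA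
    · rw [Ne, mulVec_eq_zero_iff_of_unit]
      simp
    · intro hz
      have := mulVec_dotProduct_vecMul_inv A (Pi.single 2 1) (Pi.single 2 1)
      rw [hz] at this
      simp at this
    all_goals
      rw [mulVec_dotProduct_vecMul_inv]
      simp

theorem mk_mem_ovoidSet {N : TraceZero F} (hN : N ≠ 0) :
    Projectivization.mk F N hN ∈ ovoidSet F ↔ IsNil N.1 := by
  rw [ovoidSet, Set.mem_ofPred_eq]
  simp only [mk_le]
  exact ⟨fun ⟨x, hx, h⟩ => isNil_of_mem_hexPlane hx h, fun h => exists_mem_hexPlane_of_isNil h hN⟩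

theorem form7_apply (N : TraceZero F) : form7 F N = form8 F N.1 := rfl

theorem mk_mem_quadricPoints {V : Type*} [AddCommGroup V] [Module F V] (Q : QuadraticForm F V)
    {v : V} (hv : v ≠ 0) : Projectivization.mk F v hv ∈ quadricPoints Q ↔ Q v = 0 := by
  rw [quadricPoints, Set.mem_ofPred_eq, Projectivization.submodule_mk]
  constructor
  · intro h
    exact h v (Submodule.mem_span_singleton_self v)
  · intro h w hw
    obtain ⟨c, rfl⟩ := Submodule.mem_span_singleton.mp hw
    rw [QuadraticMap.map_smul, h, smul_zero]

theorem rank_le_two_iff (M : Matrix (Fin 3) (Fin 3) F) : M.rank ≤ 2 ↔ M.det = 0 := by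
  constructor
  · intro h
    by_contra h0
    rw [rank_of_det_ne_zero h0, Fintype.card_fin] at h
    omega
  · intro h
    obtain ⟨v, hv, hv0⟩ := exists_mulVec_eq_zero_iff.mpr h
    have hk : 0 < Module.finrank F (LinearMap.ker M.mulVecLin) := by
      rw [Module.finrank_pos_iff_exists_ne_zero]
      exact ⟨⟨v, by simpa using hv0⟩, fun h => hv (Subtype.ext_iff.mp h)⟩
    have := LinearMap.finrank_range_add_finrank_ker M.mulVecLin
    rw [Module.finrank_fin_fun] at this
    rw [Matrix.rank]
    omega

theorem ovoidSet_eq : ovoidSet F =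
    {P | P ∈ quadricPoints (form7 F) ∧
      ∀ M ∈ P.submodule, (M : Matrix (Fin 3) (Fin 3) F).rank ≤ 2} := by
  ext P
  induction P using Projectivization.ind with
  | h N hN =>
    rw [mk_mem_ovoidSet, Set.mem_ofPred_eq, mk_mem_quadricPoints, form7_apply,
      Projectivization.submodule_mk]
    constructor
    · rintro ⟨⟨-, h⟩, hd⟩
      refine ⟨h, fun M hM => ?_⟩
      obtain ⟨c, rfl⟩ := Submodule.mem_span_singleton.mp hM
      rw [rank_le_two_iff, Submodule.coe_smul, det_smul, hd, mul_zero]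
    · rintro ⟨h, hr⟩
      exact ⟨⟨trace_coe N, h⟩, (rank_le_two_iff _).mp
        (hr N (Submodule.mem_span_singleton_self N))⟩

end FlagGeometryOfHexagon

/-! ### Hyperbolicity from a primitive cube root of unity -/

section Hyperbolic

variable {F : Type*} [Field F]

/-- Cauchy's theorem in the unit group, whose order `q - 1` is divisible by `3`. -/
theorem exists_isCubeRoot [Finite F] (hq : Nat.card F ≡ 1 [MOD 3]) : ∃ ω : F, IsCubeRoot ω := by
  have h3 : 3 ∣ Nat.card Fˣ := by
    rw [Nat.card_units]
    exact (Nat.modEq_iff_dvd' Nat.card_pos).mp hq.symm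
  have : Fact (Nat.Prime 3) := ⟨Nat.prime_three⟩
  obtain ⟨u, hu⟩ := exists_prime_orderOf_dvd_card' 3 h3
  have h1 : (u : F) ^ 3 = 1 := by
    have := pow_orderOf_eq_one u
    rw [hu] at this
    rw [← Units.val_pow_eq_pow_val, this, Units.val_one]
  have h2 : (u : F) ≠ 1 := by
    intro h
    have : u = 1 := Units.ext h
    rw [this, orderOf_one] at hu
    omega
  refine ⟨u, ?_, fun h => h2 ?_⟩
  · apply mul_left_cancel₀ (sub_ne_zero.mpr h2)
    linear_combination h1
  · apply mul_left_cancel₀ u.ne_zero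
    linear_combination -h

/-- Hyperbolic coordinates for the form on the trace-zero matrices. -/
def hyperbolicMap (ω : F) :
    TraceZero F →ₗ[F] Module.Dual F (Fin 4 → F) × (Fin 4 → F) where
  toFun M := (dotProductEquiv F (Fin 4) ![M.1 0 1, M.1 0 2, M.1 1 2, M.1 0 0 - ω * M.1 1 1],
    ![M.1 1 0, M.1 2 0, M.1 2 1, M.1 0 0 - ω ^ 2 * M.1 1 1])
  map_add' M N := by
    refine Prod.ext ?_ ?_
    · simp only [Prod.fst_add, ← map_add]
      congr 1
      ext i
      fin_cases i <;> simp
      ring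
    · ext i
      fin_cases i <;> simp
      ring
  map_smul' c M := by
    refine Prod.ext ?_ ?_
    · simp only [Prod.smul_fst, ← map_smul, RingHom.id_apply]
      congr 1
      ext i
      fin_cases i <;> simp
      ring
    · ext i
      fin_cases i <;> simp
      ring

theorem hyperbolicMap_bijective {ω : F} (hω : IsCubeRoot ω) :
    Function.Bijective (hyperbolicMap ω) := by
  -- This is, up to sign, the determinant of the change of diagonal coordinates `(x, y) ↦ (x - ω y,
  -- x - ω² y)`.
  have hne : ω ^ 2 - ω ≠ 0 := sub_ne_zero.mpr hω.2.symm
  constructor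
  · rw [← LinearMap.ker_eq_bot, LinearMap.ker_eq_bot']
    intro M hM
    have h1 := (dotProductEquiv F (Fin 4)).map_eq_zero_iff.mp (Prod.ext_iff.mp hM).1
    have h2 := (Prod.ext_iff.mp hM).2
    have a0 := congrFun h1 0
    have a1 := congrFun h1 1
    have a2 := congrFun h1 2
    have a3 := congrFun h1 3
    have b0 := congrFun h2 0
    have b1 := congrFun h2 1
    have b2 := congrFun h2 2
    have b3 := congrFun h2 3
    simp [hyperbolicMap] at a0 a1 a2 a3 b0 b1 b2 b3
    have m11 : M.1 1 1 = 0 := by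
      apply mul_left_cancel₀ hne
      linear_combination a3 - b3
    have m00 : M.1 0 0 = 0 := by
      linear_combination a3 + ω * m11
    have m22 : M.1 2 2 = 0 := by
      have := trace_coe M
      rw [trace_fin_three, m00, m11] at this
      simpa using this
    refine Subtype.ext ?_
    ext i j
    fin_cases i <;> fin_cases j <;> simp [*]
  · rintro ⟨f, x⟩
    obtain ⟨y, rfl⟩ := (dotProductEquiv F (Fin 4)).surjective f
    set m := (y 3 - x 3) / (ω ^ 2 - ω) with hm
    have hm' : m * (ω ^ 2 - ω) = y 3 - x 3 := div_mul_cancel₀ _ hne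
    refine ⟨⟨!![y 3 + ω * m, y 0, y 1; x 0, m, y 2; x 1, x 2, -(y 3 + ω * m) - m], ?_⟩, ?_⟩
    · rw [LinearMap.mem_ker, traceLinearMap_apply, trace_fin_three]
      simp
    · refine Prod.ext ?_ ?_
      · simp only [hyperbolicMap, LinearMap.coe_mk, AddHom.coe_mk]
        congr 1
        ext i
        fin_cases i <;> simp
      · ext i
        fin_cases i <;> simp [hyperbolicMap]
        linear_combination -hm'

/-- Eliminating the last diagonal entry by the trace, the diagonal part becomes `x² + x y + y² = (x
- ω y) (x - ω² y)`, a fourth hyperbolic pair next to the three off-diagonal ones; this holds in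
every characteristic where `ω ≠ ω²`. -/
theorem isHyperbolic_form7 {ω : F} (hω : IsCubeRoot ω) : IsHyperbolic (form7 F) 4 := by
  refine ⟨⟨LinearEquiv.ofBijective (hyperbolicMap ω) (hyperbolicMap_bijective hω), fun M => ?_⟩⟩
  have ht := trace_coe M
  rw [trace_fin_three] at ht
  change dotProductEquiv F (Fin 4) ![M.1 0 1, M.1 0 2, M.1 1 2, M.1 0 0 - ω * M.1 1 1]
    ![M.1 1 0, M.1 2 0, M.1 2 1, M.1 0 0 - ω ^ 2 * M.1 1 1] = _
  rw [dotProductEquiv_apply_apply, form7_apply, form8_apply]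
  simp [dotProduct, Fin.sum_univ_four]
  linear_combination (M.1 0 0 + M.1 1 1) * ht +
    (-M.1 0 0 * M.1 1 1 + (ω - 1) * M.1 1 1 ^ 2) * hω.1

end Hyperbolic

/-! ### From matrix counts to the ovoid property -/

section Ovoid

variable {F : Type*} [Field F] [Finite F]

/-- Each point of a projective space over `F` is represented by `q - 1` nonzero vectors. -/
theorem card_cone_eq {V : Type*} [AddCommGroup V] [Module F V] [Finite V] (S : Set (ℙ F V)) :
    (Nat.card {v : V // ∃ h : v ≠ 0, Projectivization.mk F v h ∈ S} : ℤ) =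
      (Nat.card F - 1) * S.ncard := by
  have hmk : ∀ (x : ℙ F V) (c : Fˣ) (h : c • x.rep ≠ 0), Projectivization.mk F _ h = x := by
    intro x c h
    conv_rhs => rw [← x.mk_rep]
    exact (Projectivization.mk_eq_mk_iff F _ _ _ _).mpr ⟨c, rfl⟩
  have h0 : ∀ (x : ℙ F V) (c : Fˣ), c • x.rep ≠ 0 := fun x c =>
    (smul_ne_zero_iff_ne c).mpr x.rep_nonzero
  have h : Nat.card (S × Fˣ) =
      Nat.card {v : V // ∃ h : v ≠ 0, Projectivization.mk F v h ∈ S} := by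
    refine Nat.card_congr (Equiv.ofBijective (fun p => ⟨p.2 • p.1.1.rep, h0 _ _, ?_⟩) ⟨?_, ?_⟩)
    · rw [hmk]
      exact p.1.2
    · rintro ⟨⟨x, hx⟩, c⟩ ⟨⟨y, hy⟩, d⟩ hp
      have hp' : c • x.rep = d • y.rep := Subtype.ext_iff.mp hp
      have hxy : x = y := by
        rw [← hmk x c (h0 x c), ← hmk y d (h0 y d)]
        congr 1
      subst hxy
      have hcd : (c : F) = d := smul_left_injective F x.rep_nonzero hp'
      rw [Units.ext hcd]
    · rintro ⟨v, hv, hS⟩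
      obtain ⟨a, ha⟩ := Projectivization.exists_smul_eq_mk_rep F v hv
      refine ⟨(⟨_, hS⟩, a⁻¹), Subtype.ext ?_⟩
      simp only
      rw [← ha, inv_smul_smul]
  rw [← h, Nat.card_prod, Nat.card_coe_set_eq, Nat.card_units,
    Nat.cast_mul, Nat.cast_sub Nat.card_pos]
  push_cast
  ring

theorem mk_mem_perp {V : Type*} {F : Type*} [Field F] [AddCommGroup V] [Module F V]
    (Q : QuadraticForm F V) {v w : V} (hv : v ≠ 0) (hw : w ≠ 0) :
    Projectivization.mk F w hw ∈ perp Q (Projectivization.mk F v hv) ↔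
      Q w = 0 ∧ QuadraticMap.polar Q v w = 0 := by
  rw [perp, Set.mem_ofPred_eq, mk_mem_quadricPoints, Projectivization.submodule_mk,
    Projectivization.submodule_mk]
  refine and_congr_right fun _ => ⟨fun h => ?_, fun h v' hv' w' hw' => ?_⟩
  · exact h v (Submodule.mem_span_singleton_self v) w (Submodule.mem_span_singleton_self w)
  · obtain ⟨c, rfl⟩ := Submodule.mem_span_singleton.mp hv'
    obtain ⟨d, rfl⟩ := Submodule.mem_span_singleton.mp hw'
    rw [QuadraticMap.polar_smul_left, QuadraticMap.polar_smul_right, h, smul_zero, smul_zero]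

theorem polar_form7 {F : Type*} [Field F] (M N : TraceZero F) :
    QuadraticMap.polar (form7 F) M N = (M.1 * N.1).trace :=
  polar_form8 (trace_coe M) N.1

/-- Passes from projective points to matrices: `q - 1` nonzero matrices per point, and the `- 1`
removes the zero matrix, which is nilpotent and orthogonal to everything. -/
theorem ncard_perp_inter_ovoidSet {M : TraceZero F} (hM : M ≠ 0) :
    ((Nat.card F : ℤ) - 1) *
      (perp (form7 F) (Projectivization.mk F M hM) ∩ ovoidSet F).ncard =
      Nat.card {N : Matrix (Fin 3) (Fin 3) F // IsNil N ∧ (M.1 * N).trace = 0} - 1 := by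
  rw [← card_cone_eq, ← card_ne_zero_and _ ⟨isNil_zero, by simp⟩]
  congr 1
  refine Nat.card_congr
    { toFun := fun N => ⟨N.1.1, ?_⟩
      invFun := fun N => ⟨⟨N.1, N.2.2.1.1.1⟩, fun h => N.2.1 (Subtype.ext_iff.mp h), ?_, ?_⟩
      left_inv := fun _ => rfl
      right_inv := fun _ => rfl }
  · obtain ⟨N, hN, hp, ho⟩ := N
    rw [mk_mem_perp, polar_form7] at hp
    exact ⟨fun h => hN (Subtype.ext h), (mk_mem_ovoidSet hN).mp ho, hp.2⟩
  · rw [mk_mem_perp, polar_form7]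
    exact ⟨N.2.2.1.1.2, N.2.2.2⟩
  · rw [mk_mem_ovoidSet]
    exact N.2.2.1

theorem isMOvoid_ovoidSet {ω : F} (hω : IsCubeRoot ω) :
    IsMOvoid (form7 F) 4 (Nat.card F ^ 2 + Nat.card F + 1) (ovoidSet F) := by
  have hq' : (Nat.card F : ℤ) - 1 ≠ 0 := by
    have := one_lt_card (F := F)
    omega
  refine ⟨by norm_num, isHyperbolic_form7 hω, ?_, Nat.succ_pos _, ?_, ?_⟩
  · rw [ovoidSet_eq]
    exact fun P hP => hP.1
  · intro P _ hP
    induction P using Projectivization.ind with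
    | h M hM =>
      have h := ncard_perp_inter_ovoidSet hM
      rw [mk_mem_ovoidSet] at hP
      rw [card_nil_orthogonal_of_isNil hP fun h => hM (Subtype.ext h)] at h
      -- `q⁵ - 1 = (q - 1) ((q² + q) (q² + 1) + 1)`, where `q² + 1` is the value of `theta` at index
      -- `3`.
      apply mul_left_cancel₀ hq'
      rw [h]
      simp only [theta]
      push_cast
      ring
  · intro P hQ hP
    induction P using Projectivization.ind with
    | h M hM =>
      have h := ncard_perp_inter_ovoidSet hM
      rw [mk_mem_ovoidSet] at hP
      rw [mk_mem_quadricPoints] at hQ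
      have hM' : IsQuadricMatrix M.1 := ⟨trace_coe M, hQ⟩
      rw [card_nil_orthogonal_of_det_ne_zero hω hM' fun hd => hP ⟨hM', hd⟩] at h
      -- `q⁵ + q³ - q² - 1 = (q - 1) (q² + q + 1) (q² + 1)`.
      apply mul_left_cancel₀ hq'
      rw [h]
      simp only [theta]
      push_cast
      ring

end Ovoid

/-! ### The action of `PGL(3, q)` -/

section Group

variable {F : Type*} [Field F]

theorem conjHom_apply (A : GL (Fin 3) F) (M : TraceZero F) :
    (conjHom F A M).1 = A.1 * M.1 * (A⁻¹).1 := rfl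

theorem conjHom_ne_zero (A : GL (Fin 3) F) {M : TraceZero F} (hM : M ≠ 0) :
    conjHom F A M ≠ 0 := by
  intro h
  apply hM
  refine Subtype.ext ((conjEquiv A).injective ?_)
  change A.1 * M.1 * (A⁻¹).1 = A.1 * 0 * (A⁻¹).1
  rw [← conjHom_apply, h]
  simp

theorem conjPerm_mk (A : GL (Fin 3) F) {M : TraceZero F} (hM : M ≠ 0) :
    conjPerm F A (Projectivization.mk F M hM) =
      Projectivization.mk F (conjHom F A M) (conjHom_ne_zero A hM) := rfl

/-- Fixing every point means `A M = c M A` with `c` depending on `M`. The matrices `E_ij` with `i ≠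
j` force `A` to be diagonal, and the sums `E_ij + E_ik` force its diagonal entries to coincide. -/
theorem mem_center_of_conjPerm_eq_one (A : GL (Fin 3) F) (hA : conjPerm F A = 1) :
    A ∈ Subgroup.center (GL (Fin 3) F) := by
  have key : ∀ M : Matrix (Fin 3) (Fin 3) F, M.trace = 0 →
      ∃ c : F, A.1 * M = c • (M * A.1) := by
    intro M ht
    by_cases h0 : M = 0
    · exact ⟨0, by simp [h0]⟩
    · have hM : (⟨M, ht⟩ : TraceZero F) ≠ 0 := fun h => h0 (Subtype.ext_iff.mp h)
      have h := conjPerm_mk A hM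
      rw [hA, Equiv.Perm.one_apply, eq_comm, Projectivization.mk_eq_mk_iff'] at h
      obtain ⟨c, hc⟩ := h
      have hc' : c • M = A.1 * M * (A⁻¹).1 := Subtype.ext_iff.mp hc
      refine ⟨c, ?_⟩
      have hinv : (A⁻¹).1 * A.1 = 1 := by simp
      rw [← smul_mul_assoc, hc', mul_assoc, hinv, mul_one]
  have hdet : A.1.det ≠ 0 := ((isUnit_iff_isUnit_det A.1).mp A.isUnit).ne_zero
  have diag : ∀ i j : Fin 3, i ≠ j → A.1 i j = 0 := by
    intro k i hki
    obtain ⟨j, hj⟩ : ∃ j : Fin 3, j ≠ i := exists_ne i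
    obtain ⟨c, hc⟩ := key (Matrix.single i j 1) (trace_single_eq_of_ne i j 1 hj.symm)
    have := congrFun (congrFun hc k) j
    simpa [hki] using this
  have hne : ∀ i : Fin 3, A.1 i i ≠ 0 := by
    intro i h
    apply hdet
    rw [det_fin_three, diag 0 1 (by decide), diag 0 2 (by decide), diag 1 2 (by decide)]
    fin_cases i <;> simp_all
  have eqd : ∀ i j k : Fin 3, i ≠ j → i ≠ k → A.1 j j = A.1 k k := by
    intro i j k hij hik
    by_cases hjk : j = k
    · rw [hjk]
    obtain ⟨c, hc⟩ := key (Matrix.single i j 1 + Matrix.single i k 1)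
      (by rw [trace_add, trace_single_eq_of_ne i j 1 hij, trace_single_eq_of_ne i k 1 hik,
        add_zero])
    have e1 := congrFun (congrFun hc i) j
    have e2 := congrFun (congrFun hc i) k
    simp [mul_add, add_mul, hjk, Ne.symm hjk, diag _ _ hjk, diag _ _ (Ne.symm hjk)] at e1 e2
    have hc0 : c ≠ 0 := by
      rintro rfl
      exact hne i (by simpa using e1)
    -- Both entries of the sum share one scalar `c`, so `A i i = c A j j = c A k k`.
    exact mul_left_cancel₀ hc0 (e1.symm.trans e2)
  rw [Matrix.GeneralLinearGroup.mem_center_iff_val_mem_range_scalar]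
  refine ⟨A.1 0 0, ?_⟩
  have d1 : A.1 0 0 = A.1 1 1 := eqd 2 0 1 (by decide) (by decide)
  have d2 : A.1 0 0 = A.1 2 2 := eqd 1 0 2 (by decide) (by decide)
  ext i j
  by_cases hij : i = j
  · subst hij
    fin_cases i <;> simp [← d1, ← d2]
  · simp [hij, diag i j hij]

theorem pglPerm_mk (A : GL (Fin 3) F) : pglPerm F (QuotientGroup.mk A) = conjPerm F A := rfl

theorem pglPerm_injective : Function.Injective (pglPerm F) := by
  rw [injective_iff_map_eq_one]
  intro g hg
  induction g using QuotientGroup.induction_on with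
  | H A =>
    rw [pglPerm_mk] at hg
    exact (QuotientGroup.eq_one_iff A).mpr (mem_center_of_conjPerm_eq_one A hg)

/-- Invariance under all group elements only needs the forward inclusion; the reverse one comes from
applying it to `g⁻¹`. -/
theorem pglPerm_image_eq {S : Set (ℙ F (TraceZero F))}
    (hS : ∀ (A : GL (Fin 3) F) (M : TraceZero F) (hM : M ≠ 0), Projectivization.mk F M hM ∈ S →
      Projectivization.mk F (conjHom F A M) (conjHom_ne_zero A hM) ∈ S) (g : PGL3 F) :
    pglPerm F g '' S = S := by
  have hsub : ∀ g : PGL3 F, ∀ P ∈ S, pglPerm F g P ∈ S := by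
    intro g P hP
    induction g using QuotientGroup.induction_on with
    | H A =>
      induction P using Projectivization.ind with
      | h M hM => exact hS A M hM hP
  refine Set.Subset.antisymm ?_ fun P hP => ?_
  · rintro _ ⟨P, hP, rfl⟩
    exact hsub g P hP
  · refine ⟨pglPerm F g⁻¹ P, hsub _ P hP, ?_⟩
    rw [← Equiv.Perm.mul_apply, ← map_mul, mul_inv_cancel, map_one, Equiv.Perm.one_apply]

theorem pglPerm_image_quadricPoints (g : PGL3 F) :
    pglPerm F g '' quadricPoints (form7 F) = quadricPoints (form7 F) := by
  refine pglPerm_image_eq (fun A M hM h => ?_) g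
  rw [mk_mem_quadricPoints, form7_apply] at h ⊢
  rw [conjHom_apply, form8_conj, h]

theorem pglPerm_image_hexPoints (g : PGL3 F) : pglPerm F g '' hexPoints F = hexPoints F := by
  refine pglPerm_image_eq (fun A M hM h => ?_) g
  rw [mk_mem_hexPoints] at h ⊢
  obtain ⟨a, b, hab⟩ := h
  exact ⟨_, _, by rw [conjHom_apply, hab, conj_vecMulVec]⟩

theorem pglPerm_image_ovoidSet (g : PGL3 F) : pglPerm F g '' ovoidSet F = ovoidSet F := by
  refine pglPerm_image_eq (fun A M hM h => ?_) g
  rw [mk_mem_ovoidSet] at h ⊢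
  rwa [conjHom_apply, isNil_conj]

end Group

end ThinHexagon

theorem theorem3p2 (F : Type*) [Field F] [Finite F] (hq : Nat.card F ≡ 1 [MOD 3]) :
    -- the geometry `Γ` is the flag geometry of `PG(2, q)`
    (∃ (e : ThinHexagon.hexPoints F ≃ ThinHexagon.Flag F)
        (f : ThinHexagon.hexLines F ≃ ℙ F (Fin 3 → F) ⊕ ThinHexagon.PlaneLine F),
        ∀ (x : ThinHexagon.hexPoints F) (ℓ : ThinHexagon.hexLines F),
          x.1.submodule ≤ ℓ.1 ↔ ThinHexagon.flagIncident (e x) (f ℓ)) ∧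
    -- through each point `x` of `Γ` there are two lines, spanning a plane `π_x` of the quadric
    (∀ x ∈ ThinHexagon.hexPoints F,
        (ThinHexagon.hexLinesThrough x).ncard = 2 ∧
        Module.finrank F (ThinHexagon.hexPlane x) = 3 ∧
        ∀ P : ℙ F (ThinHexagon.TraceZero F), P.submodule ≤ ThinHexagon.hexPlane x →
          P ∈ ThinHexagon.quadricPoints (ThinHexagon.form7 F)) ∧
    -- `𝒪` is a `(q² + q + 1)`-ovoid of `Q⁺(7, q)`
    ThinHexagon.IsMOvoid (ThinHexagon.form7 F) 4 (Nat.card F ^ 2 + Nat.card F + 1)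
      (ThinHexagon.ovoidSet F) ∧
    -- `𝒪` consists of the points of `Q⁺(7, q)` given by matrices of rank at most `2`
    ThinHexagon.ovoidSet F =
      {P | P ∈ ThinHexagon.quadricPoints (ThinHexagon.form7 F) ∧
        ∀ M ∈ P.submodule, (M : Matrix (Fin 3) (Fin 3) F).rank ≤ 2} ∧
    -- `PGL(3, q)` acts faithfully and preserves the quadric, `Γ` and `𝒪`
    Function.Injective (ThinHexagon.pglPerm F) ∧
    ∀ g : ThinHexagon.PGL3 F,
      ThinHexagon.pglPerm F g '' ThinHexagon.quadricPoints (ThinHexagon.form7 F) =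
        ThinHexagon.quadricPoints (ThinHexagon.form7 F) ∧
      ThinHexagon.pglPerm F g '' ThinHexagon.hexPoints F = ThinHexagon.hexPoints F ∧
      ThinHexagon.pglPerm F g '' ThinHexagon.ovoidSet F = ThinHexagon.ovoidSet F := by
  obtain ⟨ω, hω⟩ := ThinHexagon.exists_isCubeRoot hq
  refine ⟨ThinHexagon.exists_equiv_flagGeometry, fun x hx => ⟨ThinHexagon.ncard_hexLinesThrough hx,
    ThinHexagon.finrank_hexPlane hx, fun P hP => ?_⟩, ThinHexagon.isMOvoid_ovoidSet hω,
    ThinHexagon.ovoidSet_eq, ThinHexagon.pglPerm_injective, fun g =>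
    ⟨ThinHexagon.pglPerm_image_quadricPoints g, ThinHexagon.pglPerm_image_hexPoints g,
      ThinHexagon.pglPerm_image_ovoidSet g⟩⟩
  exact (ThinHexagon.isMOvoid_ovoidSet hω).subset ⟨x, hx, hP⟩
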